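/- Notation. For $f,g\in L^2(\mathbb R^d)$ let $$W(f,g)(x,\xi)=\int_{\mathbb R^d} f\left(x+\tfrac t2\right)\overline{g\left(x-\tfrac t2\right)}\,e^{-2\pi i\xi\cdot t}\,dt,\qquad (x,\xi)\in\mathbb R^{2d},$$ be the cross-Wigner distribution. A metaplectic operator with projection the symplectic matrix $S\in\mathrm{Sp}(d,\mathbb R)$ is a unitary operator $\hat S$ on $L^2(\mathbb R^d)$ such that $W(\hat Sf,\hat Sg)(z)=W(f,g)(S^{-1}z)$ for all $f,g\in L^2(\mathbb R^d)$ and $z\in\mathbb R^{2d}$; in particular this covers every $\hat S\in\mathrm{Mp}(d,\mathbb R)$. For a matrix $E$, $R(E)$ denotes its range and $E^+$ its Moore--Penrose inverse. Linear subspaces of $\mathbb R^d$ carry their Euclidean Lebesgue measure. Theorem. Let $\hat S$ be a metaplectic operator with projection $$S=\begin{pmatrix}A&B\\ C&D\end{pmatrix},\qquad A,B,C,D\in\mathbb R^{d\times d},\qquad 1\le r=\operatorname{rank}(B)\le d .$$ Let $M,N\in\mathbb R^{d\times d}$ be symmetric positive semidefinite with $\ker(M)=\ker(B)$ and $R(N)=R(B)$.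 Let $f\in L^2(\mathbb R^d)\setminus\{0\}$, and let $\alpha: D^TA(\ker(B))\to[0,\infty]$ and $\beta:A(\ker(B))\to[0,\infty]$ be measurable, almost everywhere finite functions such that for almost every $x_2\in D^TA(\ker (B))$ and almost every $\xi_2\in A(\ker (B))$ $$|f(x_1+x_2)|\le\alpha(x_2)e^{-\pi Mx_1\cdot x_1}\quad\text{for a.e. }x_1\in\ker(B)^\perp,$$ $$|\hat Sf(\xi_1+\xi_2)|\le\beta(\xi_2)e^{-\pi N\xi_1\cdot\xi_1}\quad\text{for a.e. }\xi_1\in R(B).$$ Then the matrix $MB^TNB$ has exactly $r$ non-zero eigenvalues $\lambda_1,\dots,\lambda_r$, counted with algebraic multiplicity, they are real, and: (i) $\lambda_j\le1$ for every $j=1,\dots,r$. (ii) If $\lambda_1=\dots=\lambda_r=1$, then there is $\gamma\in L^2(\ker(B))$ such that for almost every $x\in\ker(B)$ $$f(x_1+D^TAx)=\gamma(x)\,e^{-\pi(M+iB^+A)x_1\cdot x_1}\,e^{-2\pi i\,C^TAx\cdot x_1}\quad\text{for a.e. }x_1\in\ker(B)^\perp .$$ -/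

import Mathlib

noncomputable section

open MeasureTheory
open scoped ENNReal

namespace HardyMetaplectic

/-- `ℝᵈ` with its Euclidean structure. -/
abbrev Rd (d : ℕ) : Type := EuclideanSpace ℝ (Fin d)

/-- `L²(ℝᵈ)`, complex valued. -/
abbrev L2 (d : ℕ) : Type := Lp ℂ 2 (volume : Measure (Rd d))

/-- The matrix `E` acting on column vectors of `ℝᵈ`. -/
abbrev act {d : ℕ} (E : Matrix (Fin d) (Fin d) ℝ) : Rd d →ₗ[ℝ] Rd d :=
  Matrix.toEuclideanLin E

/-- The kernel of a matrix, as a subspace of `ℝᵈ`. -/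
abbrev kerM {d : ℕ} (E : Matrix (Fin d) (Fin d) ℝ) : Submodule ℝ (Rd d) :=
  LinearMap.ker (act E)

/-- The range `R(E)` of a matrix, as a subspace of `ℝᵈ`. -/
abbrev ranM {d : ℕ} (E : Matrix (Fin d) (Fin d) ℝ) : Submodule ℝ (Rd d) :=
  LinearMap.range (act E)

/-- Lebesgue measure of the Euclidean space `L` (normalized by orthonormal bases of `L`); it is not
the restriction of the Lebesgue measure of `ℝᵈ`, which vanishes on proper subspaces. On the zero
space it is the unit point mass. -/
def leb {d : ℕ} (L : Submodule ℝ (Rd d)) : Measure L :=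
  (measureSpaceOfInnerProductSpace : MeasureSpace L).volume

/-- The Moore-Penrose inverse of `E` as a linear map: the orthogonal projection onto `R(E)`
followed by the inverse of the isomorphism `ker(E)^⊥ → R(E)` induced by `E`. -/
def pinv {d : ℕ} (E : Matrix (Fin d) (Fin d) ℝ) : Rd d →ₗ[ℝ] Rd d :=
  (kerM E)ᗮ.subtype ∘ₗ
    ((act E).kerComplementEquivRange (kerM E).isCompl_orthogonal.symm).symm.toLinearMap ∘ₗ
      (ranM E).orthogonalProjectionOnto.toLinearMap

/-- The cross-Wigner distribution
`W(f,g)(x,ξ) = ∫ f(x+t/2) conj(g(x-t/2)) e^{-2πi ξ·t} dt`. For `f, g ∈ L²` the integrand is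
integrable for every `(x, ξ)`. -/
def wigner {d : ℕ} (f g : L2 d) (z : Rd d × Rd d) : ℂ :=
  ∫ t : Rd d, f (z.1 + (2⁻¹ : ℝ) • t) * starRingEnd ℂ (g (z.1 - (2⁻¹ : ℝ) • t)) *
    Complex.exp (-(2 * Real.pi * Complex.I * (inner ℝ z.2 t : ℝ)))

/-- A `2d × 2d` matrix in block form acting on `(x, ξ) ∈ ℝᵈ × ℝᵈ`. -/
def blockAct {d : ℕ} (S : Matrix (Fin d ⊕ Fin d) (Fin d ⊕ Fin d) ℝ) (z : Rd d × Rd d) :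
    Rd d × Rd d :=
  (act S.toBlocks₁₁ z.1 + act S.toBlocks₁₂ z.2, act S.toBlocks₂₁ z.1 + act S.toBlocks₂₂ z.2)

/-- `T` is a metaplectic operator with projection `S`: `S` is symplectic and `T` is a unitary
operator of `L²(ℝᵈ)` with `W(Tf,Tg)(z) = W(f,g)(S⁻¹z)` for all `f, g` and all `z`. -/
structure IsMetaplectic {d : ℕ} (S : Matrix (Fin d ⊕ Fin d) (Fin d ⊕ Fin d) ℝ)
    (T : L2 d ≃ₗᵢ[ℂ] L2 d) : Prop where
  symplectic : S ∈ Matrix.symplecticGroup (Fin d) ℝ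
  covariance : ∀ (f g : L2 d) (z : Rd d × Rd d),
    wigner (T f) (T g) z = wigner f g (blockAct S⁻¹ z)

/-- The non-zero real eigenvalues of a matrix, repeated according to algebraic multiplicity. -/
def nonzeroEigenvalues {d : ℕ} (E : Matrix (Fin d) (Fin d) ℝ) : Multiset ℝ :=
  E.charpoly.roots.filter (fun t => t ≠ 0)

end HardyMetaplectic

end

open HardyMetaplectic MeasureTheory
open scoped ENNReal Matrix

/-! The theorem reduces to the classical Hardy uncertainty principle on slices, and the reduction
uses only the moduli of `T f`, never an integral formula for `T`.

The Wigner distribution consists, up to the factor 2^d, of the matrix coefficients of the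
phase-space reflections `parity z`. Covariance therefore says that T intertwines `parity (S⁻¹ z)`
with `parity z` (`IsMetaplectic.map_parity`). The product of the reflections at 0 and at (0, ξ/2) is
a pure modulation. Comparing its matrix coefficient at `T f` with the corresponding one at f
expresses the Fourier transform of |Tf|² as a modulated autocorrelation of f with shift Bᵀξ
(`IsMetaplectic.integral_normSq_mul_exp`).

Put K = ker B and V = K^⊥, and use the coordinates x = DᵀA k + v for f and y = A k + B u for `T f`,
with k in K and u, v in V. The symplectic relations make both maps isomorphisms, and they make the
modulation the increment of one real quadratic phase (`chirp`). With G the chirped f and H = `T f`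
in these coordinates, the identity says that a constant c times |H|² has the same Fourier transform
on K × V as |F_V G|², where F_V is the partial Fourier transform. Uniqueness of Fourier transforms
of finite measures gives c |H(k,u)|² = |F_V G(k,·)(u)|² almost everywhere
(`ae_normSq_eq_partial_fourier`).

For almost every k, the slice G(k,·) is then dominated by the Gaussian of M, and its Fourier
transform by that of P = BᵀNB. With R the positive square root of M and L its restriction to V,
Hardy's theorem on V gives zero slices if ⟨PLw, Lw⟩ > |w|² for some w (`hardy_le`), and Gaussian
slices if L P L is the identity (`hardy_eq`). Both rest on a one-variable Phragmén–Lindelöf argument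
along complexified lines. Finally MBᵀNB = R(RP) has the characteristic polynomial of the symmetric
matrix RPR, whose kernel is K. This gives the eigenvalue count and turns an eigenvalue above 1 into
such a vector w. -/

namespace HardyMetaplectic

/-! ### Plancherel for Fourier integrals on L¹ ∩ L², and autocorrelations. -/

section Plancherel

open scoped FourierTransform SchwartzMap ContDiff
open ComplexInnerProductSpace

variable {E : Type*} [NormedAddCommGroup E] [InnerProductSpace ℝ E] [FiniteDimensional ℝ E]
  [MeasurableSpace E] [BorelSpace E]

/-- On `L¹ ∩ L²` the `L²` Fourier transform is the Fourier integral. -/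
theorem fourier_toLp_ae_eq {g : E → ℂ} (hg : Integrable g) (hg2 : MemLp g 2) :
    (𝓕 (hg2.toLp g) : Lp ℂ 2 (volume : Measure E)) =ᵐ[volume] 𝓕 g := by
  have hcont : Continuous (𝓕 g) :=
    VectorFourier.fourierIntegral_continuous Real.continuous_fourierChar
      (by exact continuous_inner) hg
  refine ae_eq_of_integral_contDiff_smul_eq ?_ hcont.locallyIntegrable ?_
  · exact (Lp.memLp _).locallyIntegrable (by norm_num)
  intro φ hφ hφc
  have hφc' : HasCompactSupport (fun x => (φ x : ℂ)) := hφc.comp_left (g := Complex.ofReal) rfl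
  have hφ' : ContDiff ℝ ∞ (fun x => (φ x : ℂ)) := Complex.ofRealCLM.contDiff.comp hφ
  set Φ : 𝓢(E, ℂ) := hφc'.toSchwartzMap hφ' with hΦ
  have hΦx : ∀ x, Φ x = φ x := fun x => rfl
  have h1 : ∫ x, φ x • (𝓕 (hg2.toLp g) : Lp ℂ 2 (volume : Measure E)) x
      = Lp.toTemperedDistribution (𝓕 (hg2.toLp g) : Lp ℂ 2 (volume : Measure E)) Φ := by
    rw [Lp.toTemperedDistribution_apply]
    rfl
  -- Both transforms are tested against φ: the distributional one is moved onto φ by definition, the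
  -- Fourier integral by Fubini (`h3`).
  rw [h1, ← Lp.fourier_toTemperedDistribution_eq, TemperedDistribution.fourier_apply,
    Lp.toTemperedDistribution_apply]
  have h2 : ∫ x, (𝓕 Φ) x • (hg2.toLp g) x = ∫ x, (𝓕 Φ) x • g x :=
    integral_congr_ae (by filter_upwards [hg2.coeFn_toLp] with x hx; rw [hx])
  rw [h2]
  have h3 := VectorFourier.integral_fourierIntegral_smul_eq_flip (L := innerₗ E)
    Real.continuous_fourierChar (by exact continuous_inner) Φ.integrable hg
    (μ := volume) (ν := volume)
  rw [flip_innerₗ] at h3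
  exact h3

/-- A function of `L¹ ∩ L²` with vanishing Fourier transform vanishes. -/
theorem ae_eq_zero_of_fourier_eq_zero {g : E → ℂ} (hg : Integrable g) (hg2 : MemLp g 2)
    (h : ∀ w, 𝓕 g w = 0) : g =ᵐ[volume] 0 := by
  have h0 : (𝓕 (hg2.toLp g) : Lp ℂ 2 (volume : Measure E)) = 0 := by
    rw [Lp.eq_zero_iff_ae_eq_zero]
    filter_upwards [fourier_toLp_ae_eq hg hg2] with x hx
    rw [hx, h]; rfl
  have h1 : hg2.toLp g = 0 := by
    rw [← norm_eq_zero, ← Lp.norm_fourier_eq, h0, norm_zero]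
  rw [Lp.eq_zero_iff_ae_eq_zero] at h1
  exact hg2.coeFn_toLp.symm.trans h1

theorem memLp_two_fourier {g : E → ℂ} (hg : Integrable g) (hg2 : MemLp g 2) :
    MemLp (𝓕 g) 2 :=
  (memLp_congr_ae (fourier_toLp_ae_eq hg hg2)).1 (Lp.memLp _)

theorem integral_inner_fourier {g h : E → ℂ} (hg : Integrable g) (hg2 : MemLp g 2)
    (hh : Integrable h) (hh2 : MemLp h 2) :
    ∫ u, inner ℂ (𝓕 g u) (𝓕 h u) = ∫ v, inner ℂ (g v) (h v) := by
  have key := Lp.inner_fourier_eq (hg2.toLp g) (hh2.toLp h)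
  rw [L2.inner_def, L2.inner_def] at key
  have e1 : ∫ v, inner ℂ (hg2.toLp g v) (hh2.toLp h v) = ∫ v, inner ℂ (g v) (h v) :=
    integral_congr_ae (by
      filter_upwards [hg2.coeFn_toLp, hh2.coeFn_toLp] with x h1 h2; rw [h1, h2])
  have e2 : ∫ v, inner ℂ ((𝓕 (hg2.toLp g) : Lp ℂ 2 (volume : Measure E)) v)
      ((𝓕 (hh2.toLp h) : Lp ℂ 2 (volume : Measure E)) v) = ∫ v, inner ℂ (𝓕 g v) (𝓕 h v) :=
    integral_congr_ae (by
      filter_upwards [fourier_toLp_ae_eq hg hg2, fourier_toLp_ae_eq hh hh2] with x h1 h2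
      rw [h1, h2])
  rw [← e1, ← e2, key]

theorem fourier_comp_add_right (g : E → ℂ) (a u : E) :
    𝓕 (fun v => g (v + a)) u =
      Complex.exp (2 * Real.pi * Complex.I * (inner ℝ a u : ℝ)) * 𝓕 g u := by
  have := congrFun (VectorFourier.fourierIntegral_comp_add_right Real.fourierChar volume
    (innerₗ E) g a) u
  refine this.trans ?_
  rw [Circle.smul_def, Real.fourierChar_apply, smul_eq_mul]
  congr 2
  simp; ring

/-- The inverse Fourier transform of `|ĝ|²` is the autocorrelation of `g`. -/
theorem integral_normSq_fourier_mul_exp {g : E → ℂ} (hg : Integrable g) (hg2 : MemLp g 2) (a : E) :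
    ∫ u, ((‖𝓕 g u‖ ^ 2 : ℝ) : ℂ) * Complex.exp (2 * Real.pi * Complex.I * (inner ℝ a u : ℝ)) =
      ∫ v, starRingEnd ℂ (g v) * g (v + a) := by
  have hs : MeasurePreserving (fun v : E => v + a) volume volume := measurePreserving_add_right _ a
  have h := integral_inner_fourier hg hg2 (hg.comp_add_right a) (hg2.comp_measurePreserving hs)
  rw [show (∫ v, starRingEnd ℂ (g v) * g (v + a)) = ∫ v, inner ℂ (g v) (g (v + a)) from
    integral_congr_ae (by filter_upwards with v; simp [mul_comm])]
  refine Eq.trans ?_ h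
  refine integral_congr_ae (Filter.Eventually.of_forall fun u => ?_)
  have : 𝓕 (g ∘ fun v => v + a) u = _ := fourier_comp_add_right g a u
  simp only [Function.comp_def] at this ⊢
  rw [this]
  simp only [RCLike.inner_apply]
  rw [mul_assoc (Complex.exp _), Complex.mul_conj, Complex.normSq_eq_norm_sq]
  push_cast
  ring

end Plancherel

/-! ### Phragmén–Lindelöf and the one-variable Hardy theorem. -/

section PhragmenLindelof

open Complex Filter Topology

/-- Growth of order 2 is exactly critical for a quadrant, so Phragmén–Lindelöf is applied in the
narrower sectors 0 < arg < θ < π/2, after multiplying H by exp(i s w²). The price of this factor at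
z disappears as θ tends to π/2. -/
theorem norm_le_of_gaussian_growth_quadrant {H : ℂ → ℂ} (hH : Differentiable ℂ H) {C a : ℝ}
    (ha : 0 ≤ a) (hC : ∀ z : ℂ, ‖H z‖ ≤ C * Real.exp (a * z.re ^ 2)) (hR : ∀ t : ℝ, ‖H t‖ ≤ C)
    {z : ℂ} (hre : 0 < z.re) (him : 0 < z.im) : ‖H z‖ ≤ C := by
  have hC0 : 0 ≤ C := (norm_nonneg _).trans (hR 0)
  have hz0 : z ≠ 0 := by rintro rfl; simp at hre
  have harg0 : 0 < z.arg := lt_of_le_of_ne (Complex.arg_nonneg_iff.2 him.le) (by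
    intro h; have := Complex.arg_eq_zero_iff.1 h.symm; exact him.ne' this.2)
  have harg1 : z.arg < Real.pi / 2 := Complex.arg_lt_pi_div_two_iff.2 (Or.inl hre)
  have key : ∀ θ ∈ Set.Ioo z.arg (Real.pi / 2),
      ‖H z‖ ≤ C * Real.exp (a * (Real.cos θ / Real.sin θ) * (z.re * z.im)) := by
    rintro θ ⟨h1, h2⟩
    have hθ0 : 0 < θ := harg0.trans h1
    have hcos : 0 < Real.cos θ := Real.cos_pos_of_mem_Ioo ⟨by linarith, h2⟩
    have hsin : 0 < Real.sin θ := Real.sin_pos_of_mem_Ioo ⟨hθ0, by linarith [Real.pi_pos]⟩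
    -- The factor exp(i s w²) has modulus exp(-2 s Re w Im w). This s makes it cancel exp(a (Re w)²)
    -- on the ray of angle θ; on the positive axis its modulus is 1.
    set s : ℝ := a * Real.cos θ / (2 * Real.sin θ) with hs
    have hs0 : 0 ≤ s := by positivity
    set f : ℂ → ℂ := fun w => H (exp w) * exp (I * s * (exp w) ^ 2) with hf
    have hnorm : ∀ w : ℂ, ‖f w‖ = ‖H (exp w)‖ *
        Real.exp (-(2 * s * ((exp w).re * (exp w).im))) := by
      intro w
      simp only [hf, norm_mul, Complex.norm_exp]
      congr 2
      simp [pow_two]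
      ring
    have hfd : Differentiable ℂ f := by
      refine (hH.comp Complex.differentiable_exp).mul ?_
      exact ((Complex.differentiable_exp.pow 2).const_mul _).cexp
    -- The exponential maps the strip 0 < Im < θ onto the sector, and quadratic growth becomes exp(a
    -- e^{2|Re w|}), which is admissible because 2 < π/θ.
    have hstrip := PhragmenLindelof.horizontal_strip (f := f) (a := 0) (b := θ) (C := C)
      (z := Complex.log z) hfd.diffContOnCl ?_ ?_ ?_ ?_ ?_
    · rw [hnorm, Complex.exp_log hz0] at hstrip
      have e : ‖H z‖ = ‖H z‖ * Real.exp (-(2 * s * (z.re * z.im))) *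
          Real.exp (2 * s * (z.re * z.im)) := by
        rw [mul_assoc, ← Real.exp_add]; simp
      rw [e]
      refine (mul_le_mul_of_nonneg_right hstrip (Real.exp_nonneg _)).trans (le_of_eq ?_)
      congr 2
      rw [hs]; field_simp
    · refine ⟨2, ?_, a, ?_⟩
      · rw [sub_zero, lt_div_iff₀ hθ0]; linarith
      · refine Asymptotics.IsBigO.of_bound C ?_
        rw [eventually_inf_principal]
        refine Eventually.of_forall fun w hw => ?_
        simp only [Set.mem_preimage, Set.mem_Ioo] at hw
        rw [hnorm, Real.norm_of_nonneg (Real.exp_nonneg _)]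
        have hc : 0 ≤ (exp w).re := by
          rw [Complex.exp_re]
          exact mul_nonneg (Real.exp_nonneg _)
            (Real.cos_nonneg_of_mem_Icc ⟨by linarith [Real.pi_pos], by linarith⟩)
        have hd : 0 ≤ (exp w).im := by
          rw [Complex.exp_im]
          exact mul_nonneg (Real.exp_nonneg _)
            (Real.sin_nonneg_of_mem_Icc ⟨hw.1.le, by linarith [Real.pi_pos]⟩)
        have h3 : Real.exp (-(2 * s * ((exp w).re * (exp w).im))) ≤ 1 := by
          rw [Real.exp_le_one_iff]
          have : 0 ≤ 2 * s * ((exp w).re * (exp w).im) := by positivity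
          linarith
        refine (mul_le_of_le_one_right (norm_nonneg _) h3).trans ((hC _).trans ?_)
        refine mul_le_mul_of_nonneg_left (Real.exp_le_exp.2 ?_) hC0
        refine mul_le_mul_of_nonneg_left ?_ ha
        have h4 : (exp w).re ^ 2 ≤ ‖exp w‖ ^ 2 := by
          rw [sq_le_sq, abs_of_nonneg (norm_nonneg (exp w))]
          exact Complex.abs_re_le_norm _
        refine h4.trans ?_
        rw [Complex.norm_exp, ← Real.exp_nat_mul]
        apply Real.exp_le_exp.2
        push_cast
        linarith [le_abs_self w.re]
    · intro w hw
      have h5 : exp w = ((Real.exp w.re : ℝ) : ℂ) := by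
        apply Complex.ext <;> simp [Complex.exp_re, Complex.exp_im, hw]
      rw [hnorm, h5]
      simpa using hR (Real.exp w.re)
    · intro w hw
      rw [hnorm]
      refine (mul_le_mul_of_nonneg_right (hC _) (Real.exp_nonneg _)).trans (le_of_eq ?_)
      rw [mul_assoc, ← Real.exp_add]
      have : a * (exp w).re ^ 2 + -(2 * s * ((exp w).re * (exp w).im)) = 0 := by
        rw [Complex.exp_re, Complex.exp_im, hw, hs]
        field_simp
        ring
      rw [this, Real.exp_zero, mul_one]
    · rw [Complex.log_im]; exact harg0.le
    · rw [Complex.log_im]; exact h1.le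
  have hlim : Tendsto (fun θ : ℝ => C * Real.exp (a * (Real.cos θ / Real.sin θ) * (z.re * z.im)))
      (𝓝[<] (Real.pi / 2)) (𝓝 C) := by
    have hc : ContinuousAt
        (fun θ : ℝ => C * Real.exp (a * (Real.cos θ / Real.sin θ) * (z.re * z.im)))
        (Real.pi / 2) := by
      have : ContinuousAt (fun θ : ℝ => Real.cos θ / Real.sin θ) (Real.pi / 2) :=
        Real.continuous_cos.continuousAt.div Real.continuous_sin.continuousAt (by simp)
      fun_prop
    have := hc.tendsto.mono_left (nhdsWithin_le_nhds (s := Set.Iio (Real.pi / 2)))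
    simpa using this
  refine ge_of_tendsto hlim ?_
  filter_upwards [Ioo_mem_nhdsLT harg1] with θ hθ using key θ hθ

/-- On the imaginary axis the growth bound is already C; the lower quadrant is reflected to the
upper one by conjugation. -/
theorem norm_le_of_gaussian_growth_right {H : ℂ → ℂ} (hH : Differentiable ℂ H) {C a : ℝ}
    (ha : 0 ≤ a) (hC : ∀ z : ℂ, ‖H z‖ ≤ C * Real.exp (a * z.re ^ 2)) (hR : ∀ t : ℝ, ‖H t‖ ≤ C)
    {z : ℂ} (hre : 0 ≤ z.re) : ‖H z‖ ≤ C := by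
  rcases hre.eq_or_lt with h | h
  · simpa [← h] using hC z
  rcases lt_trichotomy z.im 0 with h' | h' | h'
  · have hd : Differentiable ℂ (fun w => starRingEnd ℂ (H (starRingEnd ℂ w))) := fun w => by
      have := (hH (starRingEnd ℂ w)).conj_conj
      rwa [Complex.conj_conj] at this
    have := norm_le_of_gaussian_growth_quadrant hd (C := C) ha
      (fun w => by simpa using hC (starRingEnd ℂ w))
      (fun t => by simpa using hR t) (z := starRingEnd ℂ z) (by simpa using h)
      (by simpa using h')
    simpa using this
  · have : z = (z.re : ℂ) := Complex.ext rfl (by simpa using h')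
    rw [this]; exact hR _
  · exact norm_le_of_gaussian_growth_quadrant hH ha hC hR h h'

/-- An entire function of Gaussian growth in the real direction, bounded on the real line, is
bounded. -/
theorem norm_le_of_gaussian_growth {H : ℂ → ℂ} (hH : Differentiable ℂ H) {C a : ℝ}
    (ha : 0 ≤ a) (hC : ∀ z : ℂ, ‖H z‖ ≤ C * Real.exp (a * z.re ^ 2)) (hR : ∀ t : ℝ, ‖H t‖ ≤ C)
    (z : ℂ) : ‖H z‖ ≤ C := by
  rcases le_total 0 z.re with h | h
  · exact norm_le_of_gaussian_growth_right hH ha hC hR h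
  · have := norm_le_of_gaussian_growth_right (H := fun w => H (-w)) (hH.comp differentiable_neg)
      (C := C) ha (fun w => by simpa using hC (-w)) (fun t => by simpa using hR (-t)) (z := -z)
      (by simpa using h)
    simpa using this

/-- The one-variable complex-analytic form of Hardy's theorem. -/
theorem eq_gaussian_of_gaussian_bounds {F : ℂ → ℂ} (hF : Differentiable ℂ F) {C a : ℝ}
    (ha : 0 ≤ a) (hC : ∀ z : ℂ, ‖F z‖ ≤ C * Real.exp (a * z.im ^ 2))
    (hR : ∀ t : ℝ, ‖F t‖ ≤ C * Real.exp (-(a * t ^ 2))) (z : ℂ) :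
    F z = F 0 * exp (-(a * z ^ 2)) := by
  -- This factor turns growth in Im w into growth in Re w and removes the decay on the real line. H
  -- is then bounded, hence constant by Liouville.
  set H : ℂ → ℂ := fun w => F w * exp (a * w ^ 2) with hHdef
  have hH : Differentiable ℂ H := hF.mul ((differentiable_id.pow 2).const_mul _).cexp
  have hn : ∀ w : ℂ, ‖H w‖ = ‖F w‖ * Real.exp (a * (w.re ^ 2 - w.im ^ 2)) := by
    intro w
    simp only [hHdef, norm_mul, Complex.norm_exp]
    congr 2
    simp [pow_two]
  have hb : ∀ w, ‖H w‖ ≤ C := by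
    refine norm_le_of_gaussian_growth hH ha (fun w => ?_) (fun t => ?_)
    · rw [hn]
      refine (mul_le_mul_of_nonneg_right (hC w) (Real.exp_nonneg _)).trans (le_of_eq ?_)
      rw [mul_assoc, ← Real.exp_add]; congr 2; ring
    · rw [hn]
      refine (mul_le_mul_of_nonneg_right (hR t) (Real.exp_nonneg _)).trans (le_of_eq ?_)
      rw [mul_assoc, ← Real.exp_add]; simp
  have hc := hH.apply_eq_apply_of_bounded
    (isBounded_iff_forall_norm_le.2 ⟨C, by rintro _ ⟨w, rfl⟩; exact hb w⟩) z 0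
  have h0 : H 0 = F 0 := by simp [hHdef]
  rw [h0] at hc
  rw [← hc, hHdef]
  simp only
  rw [mul_assoc, ← Complex.exp_add]; simp

end PhragmenLindelof

/-! ### Hardy's theorem on a Euclidean space, for the standard Gaussian. -/

section Hardy

open Filter Topology
open scoped FourierTransform

variable {E : Type*} [NormedAddCommGroup E] [InnerProductSpace ℝ E] [FiniteDimensional ℝ E]
  [MeasurableSpace E] [BorelSpace E]

theorem integrable_exp_neg_sq_add (c : ℝ) (w : E) :
    Integrable (fun x : E => Real.exp (-Real.pi * ‖x‖ ^ 2 + c * inner ℝ w x)) := by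
  have h := (GaussianFourier.integrable_cexp_neg_mul_sq_norm_add (b := (Real.pi : ℂ))
    (by simpa using Real.pi_pos) (c : ℂ) w).norm
  refine h.congr (Eventually.of_forall fun x => ?_)
  simp only [Complex.norm_exp]
  congr 1
  rw [show (-(Real.pi : ℂ) * (‖x‖ : ℂ) ^ 2 + (c : ℂ) * ((inner ℝ w x : ℝ) : ℂ)) =
    ((-Real.pi * ‖x‖ ^ 2 + c * inner ℝ w x : ℝ) : ℂ) by push_cast; ring, Complex.ofReal_re]

theorem integral_exp_neg_sq_add (c : ℝ) (w : E) :
    ∫ x : E, Real.exp (-Real.pi * ‖x‖ ^ 2 + c * inner ℝ w x) =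
      Real.exp (c ^ 2 * ‖w‖ ^ 2 / (4 * Real.pi)) := by
  have h := GaussianFourier.integral_cexp_neg_mul_sq_norm_add (b := (Real.pi : ℂ))
    (by simpa using Real.pi_pos) (c : ℂ) w
  rw [div_self (by exact_mod_cast Real.pi_ne_zero), Complex.one_cpow, one_mul] at h
  rw [← Complex.ofReal_inj, ← integral_complex_ofReal]
  push_cast
  exact h

theorem integrable_exp_neg_sq : Integrable (fun x : E => Real.exp (-Real.pi * ‖x‖ ^ 2)) := by
  simpa using integrable_exp_neg_sq_add 0 (0 : E)

variable {g : E → ℂ} {a : ℝ}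

theorem integrable_of_gaussian_bound (hg : AEStronglyMeasurable g volume)
    (hb : ∀ᵐ x : E, ‖g x‖ ≤ a * Real.exp (-Real.pi * ‖x‖ ^ 2)) : Integrable g :=
  (integrable_exp_neg_sq.const_mul a).mono' hg hb

theorem memLp_two_of_gaussian_bound (hg : AEStronglyMeasurable g volume)
    (hb : ∀ᵐ x : E, ‖g x‖ ≤ a * Real.exp (-Real.pi * ‖x‖ ^ 2)) : MemLp g 2 := by
  rw [memLp_two_iff_integrable_sq_norm hg]
  refine (integrable_exp_neg_sq.const_mul (a ^ 2)).mono' (hg.norm.pow 2) ?_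
  filter_upwards [hb] with x hx
  rw [norm_pow, norm_norm]
  calc ‖g x‖ ^ 2 ≤ (a * Real.exp (-Real.pi * ‖x‖ ^ 2)) ^ 2 := by gcongr
    _ = a ^ 2 * (Real.exp (-Real.pi * ‖x‖ ^ 2) * Real.exp (-Real.pi * ‖x‖ ^ 2)) := by ring
    _ ≤ a ^ 2 * (Real.exp (-Real.pi * ‖x‖ ^ 2) * 1) := by
        gcongr
        rw [Real.exp_le_one_iff]
        have := Real.pi_pos
        nlinarith [sq_nonneg ‖x‖]
    _ = _ := by ring

theorem bound_nonneg (hb : ∀ᵐ x : E, ‖g x‖ ≤ a * Real.exp (-Real.pi * ‖x‖ ^ 2)) : 0 ≤ a := by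
  obtain ⟨x, hx⟩ := hb.exists
  by_contra h
  push Not at h
  have := mul_neg_of_neg_of_pos h (Real.exp_pos (-Real.pi * ‖x‖ ^ 2))
  linarith [norm_nonneg (g x)]

/-- The Fourier transform of `g` on the complexified line `ξ + ℂ w`. -/
noncomputable def fourierLine (g : E → ℂ) (ξ w : E) (z : ℂ) : ℂ :=
  ∫ x, g x * Complex.exp (-(2 * Real.pi * Complex.I *
    ((inner ℝ ξ x : ℝ) + z * (inner ℝ w x : ℝ))))

theorem fourierLine_ofReal (g : E → ℂ) (ξ w : E) (t : ℝ) :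
    fourierLine g ξ w t = 𝓕 g (ξ + t • w) := by
  rw [Real.fourier_eq', fourierLine]
  refine integral_congr_ae (Eventually.of_forall fun x => ?_)
  simp only [smul_eq_mul]
  rw [mul_comm]
  congr 2
  rw [inner_add_right, real_inner_smul_right, real_inner_comm x ξ, real_inner_comm x w]
  push_cast
  ring

theorem norm_exp_line {E : Type*} [NormedAddCommGroup E] [InnerProductSpace ℝ E]
    (ξ w x : E) (z : ℂ) :
    ‖Complex.exp (-(2 * Real.pi * Complex.I * ((inner ℝ ξ x : ℝ) + z * (inner ℝ w x : ℝ))))‖ =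
      Real.exp (2 * Real.pi * z.im * inner ℝ w x) := by
  rw [Complex.norm_exp]
  congr 1
  simp
  ring

/-- The integrand is dominated by a shifted Gaussian, whose integral is computed by completing the
square. -/
theorem norm_fourierLine_le (hb : ∀ᵐ x : E, ‖g x‖ ≤ a * Real.exp (-Real.pi * ‖x‖ ^ 2))
    (ξ w : E) (z : ℂ) :
    ‖fourierLine g ξ w z‖ ≤ a * Real.exp (Real.pi * ‖w‖ ^ 2 * z.im ^ 2) := by
  have h := norm_integral_le_of_norm_le
    (f := fun x => g x * Complex.exp (-(2 * Real.pi * Complex.I *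
      ((inner ℝ ξ x : ℝ) + z * (inner ℝ w x : ℝ)))))
    ((integrable_exp_neg_sq_add (2 * Real.pi * z.im) w).const_mul a) (by
      filter_upwards [hb] with x hx
      rw [norm_mul, norm_exp_line, Real.exp_add, ← mul_assoc]
      gcongr)
  rw [integral_const_mul, integral_exp_neg_sq_add] at h
  refine h.trans (le_of_eq ?_)
  congr 2
  have := Real.pi_ne_zero
  field_simp
  ring

theorem differentiable_fourierLine (hg : AEStronglyMeasurable g volume)
    (hb : ∀ᵐ x : E, ‖g x‖ ≤ a * Real.exp (-Real.pi * ‖x‖ ^ 2)) (ξ w : E) :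
    Differentiable ℂ (fourierLine g ξ w) := by
  intro z₀
  have ha := bound_nonneg hb
  -- One of the two extra units covers the ball of radius 1 about z₀; the other absorbs the factor
  -- 2π|⟨w,x⟩| ≤ e^{2π|⟨w,x⟩|} produced by differentiation.
  set c : ℝ := 2 * Real.pi * (|z₀.im| + 2) with hc
  have hcont : ∀ z : ℂ, Continuous fun x : E => Complex.exp (-(2 * Real.pi * Complex.I *
    ((inner ℝ ξ x : ℝ) + z * (inner ℝ w x : ℝ)))) := fun z => by fun_prop
  have hmeas : ∀ z : ℂ, AEStronglyMeasurable (fun x : E => g x * Complex.exp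
      (-(2 * Real.pi * Complex.I * ((inner ℝ ξ x : ℝ) + z * (inner ℝ w x : ℝ))))) volume :=
    fun z => hg.mul (hcont z).aestronglyMeasurable
  have key := hasDerivAt_integral_of_dominated_loc_of_deriv_le (μ := (volume : Measure E))
    (F := fun z x => g x * Complex.exp (-(2 * Real.pi * Complex.I *
      ((inner ℝ ξ x : ℝ) + z * (inner ℝ w x : ℝ)))))
    (F' := fun z x => g x * (Complex.exp (-(2 * Real.pi * Complex.I *
      ((inner ℝ ξ x : ℝ) + z * (inner ℝ w x : ℝ)))) *
        (-(2 * Real.pi * Complex.I * (inner ℝ w x : ℝ)))))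
    (x₀ := z₀) (s := Metric.ball z₀ 1) (Metric.ball_mem_nhds _ one_pos)
    (bound := fun x => a * (Real.exp (-Real.pi * ‖x‖ ^ 2 + c * inner ℝ w x) +
      Real.exp (-Real.pi * ‖x‖ ^ 2 + (-c) * inner ℝ w x)))
    (Eventually.of_forall hmeas) ?_ ?_ ?_ ?_ ?_
  · exact key.2.differentiableAt
  · refine ((integrable_exp_neg_sq_add (2 * Real.pi * z₀.im) w).const_mul a).mono' (hmeas _) ?_
    filter_upwards [hb] with x hx
    rw [norm_mul, norm_exp_line, Real.exp_add, ← mul_assoc]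
    gcongr
  · refine hg.mul (Continuous.aestronglyMeasurable ?_)
    exact (hcont z₀).mul (by fun_prop)
  · filter_upwards [hb] with x hx z hz
    rw [norm_mul, norm_mul, norm_exp_line]
    set t := inner ℝ w x with ht
    have h1 : ‖-(2 * (Real.pi : ℂ) * Complex.I * (t : ℂ))‖ = 2 * Real.pi * |t| := by
      simp [abs_of_pos Real.pi_pos]
    rw [h1]
    have him : |z.im| ≤ |z₀.im| + 1 := by
      have h2 : |(z - z₀).im| ≤ ‖z - z₀‖ := Complex.abs_im_le_norm _
      rw [Metric.mem_ball, dist_eq_norm] at hz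
      have h3 : |z.im| ≤ |z₀.im| + |(z - z₀).im| := by
        have := abs_add_le z₀.im (z - z₀).im
        simpa using this
      linarith
    have hpi := Real.pi_pos
    have h4 : Real.exp (2 * Real.pi * z.im * t) ≤ Real.exp (2 * Real.pi * (|z₀.im| + 1) * |t|) := by
      apply Real.exp_le_exp.2
      calc 2 * Real.pi * z.im * t = 2 * Real.pi * (z.im * t) := by ring
        _ ≤ 2 * Real.pi * (|z.im| * |t|) := by
          refine mul_le_mul_of_nonneg_left ?_ (by positivity)
          rw [← abs_mul]; exact le_abs_self _
        _ ≤ 2 * Real.pi * ((|z₀.im| + 1) * |t|) := by gcongr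
        _ = _ := by ring
    have h5 : 2 * Real.pi * |t| ≤ Real.exp (2 * Real.pi * |t|) := by
      linarith [Real.add_one_le_exp (2 * Real.pi * |t|)]
    have h6 : Real.exp (2 * Real.pi * z.im * t) * (2 * Real.pi * |t|) ≤ Real.exp (c * |t|) := by
      calc _ ≤ Real.exp (2 * Real.pi * (|z₀.im| + 1) * |t|) * Real.exp (2 * Real.pi * |t|) := by
            gcongr
        _ = _ := by rw [← Real.exp_add, hc]; congr 1; ring
    have h7 : Real.exp (c * |t|) ≤ Real.exp (c * t) + Real.exp (-c * t) := by
      rcases abs_cases t with ⟨h, _⟩ | ⟨h, _⟩ <;> rw [h]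
      · linarith [Real.exp_pos (-c * t)]
      · rw [show c * -t = -c * t by ring]; linarith [Real.exp_pos (c * t)]
    calc ‖g x‖ * (Real.exp (2 * Real.pi * z.im * t) * (2 * Real.pi * |t|))
        ≤ (a * Real.exp (-Real.pi * ‖x‖ ^ 2)) * (Real.exp (c * t) + Real.exp (-c * t)) := by
          gcongr
          exact h6.trans h7
      _ = _ := by rw [Real.exp_add, Real.exp_add]; ring
  · exact ((integrable_exp_neg_sq_add c w).add (integrable_exp_neg_sq_add (-c) w)).const_mul a
  · refine Eventually.of_forall fun x z _ => ?_
    refine HasDerivAt.const_mul _ (HasDerivAt.cexp ?_)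
    have h := ((hasDerivAt_id z).mul_const ((inner ℝ w x : ℝ) : ℂ)).const_add
      ((inner ℝ ξ x : ℝ) : ℂ) |>.const_mul (2 * (Real.pi : ℂ) * Complex.I) |>.neg
    exact h.congr_deriv (by simp)

/-- If `ĝ` is too small in the direction `w` for a function `g` dominated by the standard Gaussian,
then `g` vanishes. -/
theorem ae_eq_zero_of_hardy (hg : AEStronglyMeasurable g volume)
    (hb : ∀ᵐ x : E, ‖g x‖ ≤ a * Real.exp (-Real.pi * ‖x‖ ^ 2)) {b : ℝ} (Q : E →ₗ[ℝ] E)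
    (hgh : ∀ ξ, ‖𝓕 g ξ‖ ≤ b * Real.exp (-Real.pi * inner ℝ (Q ξ) ξ)) {w : E}
    (hw : ‖w‖ ^ 2 < inner ℝ (Q w) w) : g =ᵐ[volume] 0 := by
  refine ae_eq_zero_of_fourier_eq_zero (integrable_of_gaussian_bound hg hb)
    (memLp_two_of_gaussian_bound hg hb) fun ξ => ?_
  have hpi := Real.pi_pos
  have hb0 : 0 ≤ b := by
    have := (norm_nonneg _).trans (hgh 0)
    simpa using this
  -- δ is the surplus of decay along w over what the growth π‖w‖² in the imaginary direction
  -- permits.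
  set δ : ℝ := inner ℝ (Q w) w - ‖w‖ ^ 2 with hδ
  have hδ0 : 0 < δ := by linarith
  set m : ℝ := inner ℝ (Q ξ) w + inner ℝ (Q w) ξ with hm
  have hq : ∀ t : ℝ, inner ℝ (Q (ξ + t • w)) (ξ + t • w) =
      inner ℝ (Q ξ) ξ + t * m + t ^ 2 * (δ + ‖w‖ ^ 2) := by
    intro t
    simp only [map_add, map_smul, inner_add_left, inner_add_right, real_inner_smul_left,
      real_inner_smul_right, hm, hδ]
    ring
  have hline : ∀ t : ℝ, ‖fourierLine g ξ w t‖ ≤ b * Real.exp (-Real.pi *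
      (inner ℝ (Q ξ) ξ + t * m + t ^ 2 * (δ + ‖w‖ ^ 2))) := by
    intro t
    rw [fourierLine_ofReal, ← hq]
    exact hgh _
  -- Half of the surplus absorbs the linear term coming from the base point ξ; the other half is
  -- kept.
  have hquad : ∀ t : ℝ, - (t * m) - t ^ 2 * δ ≤ m ^ 2 / (2 * δ) - t ^ 2 * δ / 2 := by
    intro t
    have : 0 ≤ (t * δ + m) ^ 2 / (2 * δ) := by positivity
    have e : (t * δ + m) ^ 2 / (2 * δ) = t ^ 2 * δ / 2 + t * m + m ^ 2 / (2 * δ) := by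
      field_simp; ring
    linarith
  set C' : ℝ := b * Real.exp (Real.pi * (m ^ 2 / (2 * δ) - inner ℝ (Q ξ) ξ)) with hC'
  have hline' : ∀ t : ℝ, ‖fourierLine g ξ w t‖ ≤
      C' * Real.exp (-(Real.pi * δ / 2 * t ^ 2)) * Real.exp (-(Real.pi * ‖w‖ ^ 2 * t ^ 2)) := by
    intro t
    refine (hline t).trans ?_
    rw [hC', mul_assoc, mul_assoc, ← Real.exp_add, ← Real.exp_add]
    refine mul_le_mul_of_nonneg_left (Real.exp_le_exp.2 ?_) hb0
    have := mul_le_mul_of_nonneg_left (hquad t) hpi.le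
    nlinarith [this]
  have hC'0 : 0 ≤ C' := by positivity
  have hgauss := eq_gaussian_of_gaussian_bounds (differentiable_fourierLine hg hb ξ w)
    (C := max a C') (a := Real.pi * ‖w‖ ^ 2) (by positivity)
    (fun z => (norm_fourierLine_le hb ξ w z).trans (by gcongr; exact le_max_left _ _))
    (fun t => (hline' t).trans (by
      refine mul_le_mul_of_nonneg_right ?_ (Real.exp_nonneg _)
      refine (mul_le_of_le_one_right hC'0 ?_).trans (le_max_right _ _)
      rw [Real.exp_le_one_iff]
      have : 0 ≤ Real.pi * δ / 2 * t ^ 2 := by positivity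
      linarith))
  have h0 : fourierLine g ξ w 0 = 𝓕 g ξ := by simpa using fourierLine_ofReal g ξ w 0
  -- On the line the transform is 𝓕 g ξ times exp(-π‖w‖²t²) exactly. Dividing by this Gaussian
  -- leaves a bound that tends to 0.
  have hle : ∀ t : ℝ, ‖𝓕 g ξ‖ ≤ C' * Real.exp (-(Real.pi * δ / 2 * t ^ 2)) := by
    intro t
    have h1 := hline' t
    rw [hgauss t, norm_mul, h0, Complex.norm_exp] at h1
    rw [show (-(((Real.pi * ‖w‖ ^ 2 : ℝ) : ℂ) * (t : ℂ) ^ 2)) =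
      ((-(Real.pi * ‖w‖ ^ 2 * t ^ 2) : ℝ) : ℂ) by push_cast; ring, Complex.ofReal_re] at h1
    exact le_of_mul_le_mul_right h1 (Real.exp_pos _)
  have hlim : Tendsto (fun t : ℝ => C' * Real.exp (-(Real.pi * δ / 2 * t ^ 2))) atTop (𝓝 0) := by
    have : Tendsto (fun t : ℝ => Real.pi * δ / 2 * t ^ 2) atTop atTop :=
      (tendsto_pow_atTop two_ne_zero).const_mul_atTop (by positivity)
    simpa using (Real.tendsto_exp_neg_atTop_nhds_zero.comp this).const_mul C'
  have := ge_of_tendsto hlim (Eventually.of_forall hle)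
  exact norm_le_zero_iff.1 this

/-- The extremal case of Hardy's theorem. -/
theorem ae_eq_gaussian_of_hardy (hg : AEStronglyMeasurable g volume)
    (hb : ∀ᵐ x : E, ‖g x‖ ≤ a * Real.exp (-Real.pi * ‖x‖ ^ 2)) {b : ℝ}
    (hgh : ∀ ξ, ‖𝓕 g ξ‖ ≤ b * Real.exp (-Real.pi * ‖ξ‖ ^ 2)) :
    ∀ᵐ x : E, g x = (∫ y, g y) * Complex.exp (-Real.pi * ‖x‖ ^ 2) := by
  have hgint := integrable_of_gaussian_bound hg hb
  set G : E → ℂ := fun x => Complex.exp (-Real.pi * ‖x‖ ^ 2) with hG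
  have hGm : AEStronglyMeasurable G volume := Continuous.aestronglyMeasurable (by fun_prop)
  have hGb : ∀ᵐ x : E, ‖G x‖ ≤ 1 * Real.exp (-Real.pi * ‖x‖ ^ 2) := Eventually.of_forall fun x => by
    simp only [hG, Complex.norm_exp, one_mul]
    rw [show (-(Real.pi : ℂ) * (‖x‖ : ℂ) ^ 2) = ((-Real.pi * ‖x‖ ^ 2 : ℝ) : ℂ) by push_cast; ring,
      Complex.ofReal_re]
  have hGint := integrable_of_gaussian_bound hGm hGb
  have hpi := Real.pi_pos
  -- The line through 0 in direction w is used, evaluated at parameter 1.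
  have hval : ∀ w, 𝓕 g w = (∫ y, g y) * Complex.exp (-Real.pi * ‖w‖ ^ 2) := by
    intro w
    have hgauss := eq_gaussian_of_gaussian_bounds (differentiable_fourierLine hg hb 0 w)
      (C := max a b) (a := Real.pi * ‖w‖ ^ 2) (by positivity)
      (fun z => (norm_fourierLine_le hb 0 w z).trans (by gcongr; exact le_max_left _ _))
      (fun t => by
        rw [fourierLine_ofReal, zero_add]
        refine (hgh _).trans ?_
        rw [norm_smul, mul_pow, Real.norm_eq_abs, sq_abs,
          show -Real.pi * (t ^ 2 * ‖w‖ ^ 2) = -(Real.pi * ‖w‖ ^ 2 * t ^ 2) by ring]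
        gcongr
        exact le_max_right _ _) 1
    have h1 := fourierLine_ofReal g 0 w 1
    have h0 := fourierLine_ofReal g 0 w 0
    simp only [Complex.ofReal_one, one_smul, zero_add, Complex.ofReal_zero, zero_smul] at h1 h0
    rw [h1, h0] at hgauss
    rw [hgauss, Real.fourier_eq']
    simp
  have hGval : ∀ w, 𝓕 G w = Complex.exp (-Real.pi * ‖w‖ ^ 2) := by
    intro w
    have hpc : (Real.pi : ℂ) ≠ 0 := by exact_mod_cast Real.pi_ne_zero
    rw [hG, fourier_gaussian_innerProductSpace (by simpa using hpi), div_self hpc,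
      Complex.one_cpow, one_mul]
    congr 1
    field_simp
  have hd : (g - (∫ y, g y) • G) =ᵐ[volume] 0 := by
    refine ae_eq_zero_of_fourier_eq_zero (hgint.sub (hGint.smul _))
      ((memLp_two_of_gaussian_bound hg hb).sub ((memLp_two_of_gaussian_bound hGm hGb).const_smul _))
      fun w => ?_
    have : 𝓕 (g - (∫ y, g y) • G) w = 𝓕 g w - (∫ y, g y) * 𝓕 G w := by
      simp only [Real.fourier_eq, Pi.sub_apply, Pi.smul_apply, smul_sub]
      rw [integral_sub]
      · congr 1
        rw [← smul_eq_mul, ← integral_smul]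
        refine integral_congr_ae (Eventually.of_forall fun x => ?_)
        exact smul_comm _ _ _
      · exact (Real.fourierIntegral_convergent_iff w).2 hgint
      · exact (Real.fourierIntegral_convergent_iff w).2 (hGint.smul (∫ y, g y))
    rw [this, hval, hGval, sub_self]
  filter_upwards [hd] with x hx
  simpa [sub_eq_zero, hG] using hx

end Hardy

/-! ### Haar measures under linear isomorphisms. -/

section HaarMap

variable {X Y : Type*} [NormedAddCommGroup X] [NormedSpace ℝ X]
  [MeasurableSpace X] [BorelSpace X] [NormedAddCommGroup Y] [NormedSpace ℝ Y]
  [MeasurableSpace Y] [BorelSpace Y]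

/-- A linear isomorphism scales Haar measures. -/
theorem exists_map_eq_smul_haar [FiniteDimensional ℝ Y] (e : X ≃L[ℝ] Y) (μ : Measure X)
    [μ.IsAddHaarMeasure] (ν : Measure Y) [ν.IsAddHaarMeasure] :
    ∃ c : ℝ≥0∞, c ≠ 0 ∧ c ≠ ∞ ∧ μ.map e = c • ν := by
  have := e.isAddHaarMeasure_map μ
  refine ⟨Measure.addHaarScalarFactor (μ.map e) ν, ?_, ENNReal.coe_ne_top, ?_⟩
  · exact_mod_cast (Measure.addHaarScalarFactor_pos_of_isAddHaarMeasure _ _).ne'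
  · exact Measure.isAddLeftInvariant_eq_smul _ _

theorem quasiMeasurePreserving_linearEquiv [FiniteDimensional ℝ Y] (e : X ≃L[ℝ] Y)
    (μ : Measure X) [μ.IsAddHaarMeasure] (ν : Measure Y) [ν.IsAddHaarMeasure] :
    Measure.QuasiMeasurePreserving e μ ν := by
  obtain ⟨c, -, -, h⟩ := exists_map_eq_smul_haar e μ ν
  exact ⟨e.continuous.measurable, h ▸ Measure.smul_absolutelyContinuous⟩

theorem integral_comp_of_map_eq_smul (e : X ≃L[ℝ] Y) {μ : Measure X} {ν : Measure Y} {c : ℝ≥0∞}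
    (h : μ.map e = c • ν) (g : Y → ℂ) : ∫ x, g (e x) ∂μ = c.toReal * ∫ y, g y ∂ν := by
  have h1 := integral_map_equiv (μ := μ) e.toHomeomorph.toMeasurableEquiv g
  have h2 : μ.map e.toHomeomorph.toMeasurableEquiv = c • ν := h
  rw [h2, integral_smul_measure] at h1
  rw [← Complex.real_smul]
  exact h1.symm

theorem memLp_comp_of_map_eq_smul (e : X ≃L[ℝ] Y) {μ : Measure X} {ν : Measure Y} {c : ℝ≥0∞}
    (hc : c ≠ ∞) (h : μ.map e = c • ν) {g : Y → ℂ} (hg : MemLp g 2 ν) :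
    MemLp (fun x => g (e x)) 2 μ := by
  have h1 : MemLp g 2 (μ.map e) := h ▸ hg.smul_measure hc
  exact h1.comp_of_map e.continuous.aemeasurable

end HaarMap

/-! ### Hardy's theorem for general Gaussians, by a symmetric linear change of variables. -/

section Hardy

open Filter Topology
open scoped FourierTransform

variable {E : Type*} [NormedAddCommGroup E] [InnerProductSpace ℝ E] [FiniteDimensional ℝ E]
  [MeasurableSpace E] [BorelSpace E]

theorem continuous_fourier_of_integrable {g : E → ℂ} (hg : Integrable g) : Continuous (𝓕 g) :=
  VectorFourier.fourierIntegral_continuous Real.continuous_fourierChar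
    (by exact continuous_inner) hg

variable {G : E → ℂ} {a b : ℝ} (L : E ≃L[ℝ] E)

theorem gaussian_bound_comp_symm
    (hb : ∀ᵐ x : E, ‖G x‖ ≤ a * Real.exp (-Real.pi * ‖L x‖ ^ 2)) :
    ∀ᵐ x : E, ‖G (L.symm x)‖ ≤ a * Real.exp (-Real.pi * ‖x‖ ^ 2) := by
  filter_upwards [(quasiMeasurePreserving_linearEquiv L.symm volume volume).ae hb] with x hx
  simpa using hx

theorem integrable_of_gaussian_bound_comp (hG : AEStronglyMeasurable G volume)
    (hb : ∀ᵐ x : E, ‖G x‖ ≤ a * Real.exp (-Real.pi * ‖L x‖ ^ 2)) :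
    Integrable G ∧ MemLp G 2 := by
  have hm := hG.comp_quasiMeasurePreserving
    (quasiMeasurePreserving_linearEquiv L.symm volume volume)
  have h1 := integrable_of_gaussian_bound hm (gaussian_bound_comp_symm L hb)
  have h2 := memLp_two_of_gaussian_bound hm (gaussian_bound_comp_symm L hb)
  obtain ⟨c, hc0, hc, h⟩ := exists_map_eq_smul_haar L (volume : Measure E) volume
  constructor
  · have h3 : Integrable (G ∘ L.symm) ((volume : Measure E).map L) := h ▸ h1.smul_measure hc
    simpa [Function.comp_def] using h3.comp_measurable L.continuous.measurable
  · simpa using memLp_comp_of_map_eq_smul L hc h h2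

/-- The constant is the Jacobian. Symmetry of L is what puts L itself, not its adjoint, on the
frequency side. -/
theorem exists_fourier_comp_symm (hL : ∀ x y, inner ℝ (L x) y = inner ℝ x (L y)) :
    ∃ c : ℝ, 0 ≤ c ∧ ∀ (G : E → ℂ) (ξ : E), 𝓕 (fun x => G (L.symm x)) ξ = c * 𝓕 G (L ξ) := by
  obtain ⟨c, hc0, hc, h⟩ := exists_map_eq_smul_haar L.symm (volume : Measure E) volume
  refine ⟨c.toReal, ENNReal.toReal_nonneg, fun G ξ => ?_⟩
  have h1 := integral_comp_of_map_eq_smul L.symm h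
    (fun v => Complex.exp (((-2 * Real.pi * inner ℝ v (L ξ) : ℝ) : ℂ) * Complex.I) • G v)
  rw [Real.fourier_eq', Real.fourier_eq', ← h1]
  refine integral_congr_ae (Eventually.of_forall fun x => ?_)
  simp only [← hL, ContinuousLinearEquiv.apply_symm_apply]

/-- Hardy's theorem: a non-zero function dominated by the Gaussian of `L²` whose Fourier transform
is dominated by the Gaussian of `P` satisfies `L P L ≤ 1`. -/
theorem hardy_le (hL : ∀ x y, inner ℝ (L x) y = inner ℝ x (L y))
    (hG : AEStronglyMeasurable G volume)
    (hb : ∀ᵐ x : E, ‖G x‖ ≤ a * Real.exp (-Real.pi * ‖L x‖ ^ 2)) (P : E →ₗ[ℝ] E)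
    (hGh : ∀ ξ, ‖𝓕 G ξ‖ ≤ b * Real.exp (-Real.pi * inner ℝ (P ξ) ξ)) {w : E}
    (hw : ‖w‖ ^ 2 < inner ℝ (P (L w)) (L w)) : G =ᵐ[volume] 0 := by
  obtain ⟨c, hc, hF⟩ := exists_fourier_comp_symm L hL
  have hm := hG.comp_quasiMeasurePreserving
    (quasiMeasurePreserving_linearEquiv L.symm volume volume)
  have h := ae_eq_zero_of_hardy hm (gaussian_bound_comp_symm L hb)
    (b := c * b) (Q := L.toLinearEquiv.toLinearMap ∘ₗ P ∘ₗ L.toLinearEquiv.toLinearMap)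
    (fun ξ => by
      have := hF G ξ
      simp only [Function.comp_def] at this ⊢
      rw [this, norm_mul, Complex.norm_real, Real.norm_of_nonneg hc, mul_assoc]
      refine mul_le_mul_of_nonneg_left ?_ hc
      simpa [hL] using hGh (L ξ)) (w := w) (by simpa [hL] using hw)
  filter_upwards [(quasiMeasurePreserving_linearEquiv L volume volume).ae h] with x hx
  simpa using hx

/-- The extremal case of Hardy's theorem. -/
theorem hardy_eq (hL : ∀ x y, inner ℝ (L x) y = inner ℝ x (L y))
    (hG : AEStronglyMeasurable G volume)
    (hb : ∀ᵐ x : E, ‖G x‖ ≤ a * Real.exp (-Real.pi * ‖L x‖ ^ 2)) (P : E →ₗ[ℝ] E)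
    (hGh : ∀ ξ, ‖𝓕 G ξ‖ ≤ b * Real.exp (-Real.pi * inner ℝ (P ξ) ξ))
    (hP : ∀ w, inner ℝ (P (L w)) (L w) = ‖w‖ ^ 2) :
    ∀ᵐ x : E, G x = (∫ y, G (L.symm y)) * Complex.exp (-Real.pi * ‖L x‖ ^ 2) := by
  obtain ⟨c, hc, hF⟩ := exists_fourier_comp_symm L hL
  have hm := hG.comp_quasiMeasurePreserving
    (quasiMeasurePreserving_linearEquiv L.symm volume volume)
  have h := ae_eq_gaussian_of_hardy hm (gaussian_bound_comp_symm L hb) (b := c * b)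
    (fun ξ => by
      have := hF G ξ
      simp only [Function.comp_def] at this ⊢
      rw [this, norm_mul, Complex.norm_real, Real.norm_of_nonneg hc, mul_assoc]
      refine mul_le_mul_of_nonneg_left ?_ hc
      simpa [hP] using hGh (L ξ))
  filter_upwards [(quasiMeasurePreserving_linearEquiv L volume volume).ae h] with x hx
  simpa using hx

/-- An almost everywhere inequality between continuous functions holds everywhere. -/
theorem forall_le_of_ae_le {φ ψ : E → ℝ} (hφ : Continuous φ) (hψ : Continuous ψ)
    (h : ∀ᵐ x, φ x ≤ ψ x) (x : E) : φ x ≤ ψ x := by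
  have hd := Measure.dense_of_ae h
  have hcl := (isClosed_le hφ hψ).closure_eq
  have : x ∈ closure {x | φ x ≤ ψ x} := hd x
  rwa [hcl] at this

end Hardy

/-! ### Partial Fourier transforms on a product. -/

section Slices

open Filter Topology
open scoped FourierTransform

theorem lintegral_fourier_sq {V : Type*} [NormedAddCommGroup V] [InnerProductSpace ℝ V]
    [FiniteDimensional ℝ V] [MeasurableSpace V] [BorelSpace V] {g : V → ℂ} (hg : Integrable g)
    (hg2 : MemLp g 2) : ∫⁻ u, ‖𝓕 g u‖ₑ ^ 2 = ∫⁻ v, ‖g v‖ₑ ^ 2 := by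
  have key : eLpNorm (𝓕 g) 2 volume = eLpNorm g 2 volume := by
    have h := Lp.norm_fourier_eq (hg2.toLp g)
    rw [Lp.norm_def, Lp.norm_def, eLpNorm_congr_ae (fourier_toLp_ae_eq hg hg2),
      eLpNorm_congr_ae hg2.coeFn_toLp,
      ENNReal.toReal_eq_toReal_iff' (memLp_two_fourier hg hg2).2.ne hg2.2.ne] at h
    exact h
  have e : ∀ φ : V → ℂ, eLpNorm φ 2 volume ^ (2 : ℝ) = ∫⁻ v, ‖φ v‖ₑ ^ 2 := fun φ => by
    have := eLpNorm_nnreal_pow_eq_lintegral (μ := (volume : Measure V)) (f := φ) (p := 2) (by simp)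
    simpa using this
  rw [← e, ← e, key]

variable {K V : Type*} [NormedAddCommGroup V] [InnerProductSpace ℝ V] [FiniteDimensional ℝ V]
  [MeasurableSpace V] [BorelSpace V] [NormedAddCommGroup K] [InnerProductSpace ℝ K]
  [FiniteDimensional ℝ K] [MeasurableSpace K] [BorelSpace K]

variable {G H : K × V → ℂ}

theorem aestronglyMeasurable_partial_fourier
    (hG : AEStronglyMeasurable G ((volume : Measure K).prod (volume : Measure V))) :
    AEStronglyMeasurable (fun p : K × V => 𝓕 (fun v => G (p.1, v)) p.2)
      ((volume : Measure K).prod (volume : Measure V)) := by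
  simp only [Real.fourier_eq']
  refine AEStronglyMeasurable.integral_prod_right' (μ := (volume : Measure K).prod
    (volume : Measure V)) (ν := (volume : Measure V)) (f := fun q : (K × V) × V =>
    Complex.exp (((-2 * Real.pi * inner ℝ q.2 q.1.2 : ℝ) : ℂ) * Complex.I) • G (q.1.1, q.2)) ?_
  have hcont : Continuous fun q : (K × V) × V =>
      Complex.exp (((-2 * Real.pi * inner ℝ q.2 q.1.2 : ℝ) : ℂ) * Complex.I) := by fun_prop
  refine AEStronglyMeasurable.smul hcont.aestronglyMeasurable ?_
  have hq : Measure.QuasiMeasurePreserving (fun q : (K × V) × V => (q.1.1, q.2))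
      (((volume : Measure K).prod (volume : Measure V)).prod (volume : Measure V))
      ((volume : Measure K).prod (volume : Measure V)) := by
    refine MeasureTheory.QuasiMeasurePreserving.prodMap (f := Prod.fst) (g := id) ?_ ?_
    · exact Measure.quasiMeasurePreserving_fst
    · exact Measure.QuasiMeasurePreserving.id _
  exact hG.comp_quasiMeasurePreserving hq

/-- Plancherel on almost every slice, followed by Tonelli. -/
theorem memLp_partial_fourier (hG : MemLp G 2 ((volume : Measure K).prod (volume : Measure V)))
    (hi : ∀ᵐ k : K, Integrable (fun v => G (k, v)) ∧ MemLp (fun v => G (k, v)) 2) :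
    MemLp (fun p : K × V => 𝓕 (fun v => G (p.1, v)) p.2) 2
      ((volume : Measure K).prod (volume : Measure V)) := by
  refine ⟨aestronglyMeasurable_partial_fourier hG.1, ?_⟩
  have e : ∀ φ : K × V → ℂ, AEStronglyMeasurable φ
      ((volume : Measure K).prod (volume : Measure V)) →
      eLpNorm φ 2 ((volume : Measure K).prod (volume : Measure V)) ^ (2 : ℝ) =
      ∫⁻ k, ∫⁻ v, ‖φ (k, v)‖ₑ ^ 2 := fun φ hφ => by
    have := eLpNorm_nnreal_pow_eq_lintegral (μ := (volume : Measure K).prod (volume : Measure V))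
      (f := φ) (p := 2) (by simp)
    simp only [ENNReal.coe_ofNat, NNReal.coe_ofNat, ENNReal.rpow_ofNat] at this ⊢
    rw [this, lintegral_prod _ (hφ.enorm.pow_const 2)]
  rw [← ENNReal.rpow_lt_top_iff_of_pos (y := 2) (by norm_num),
    e _ (aestronglyMeasurable_partial_fourier hG.1)]
  have h2 : ∫⁻ k : K, ∫⁻ v : V, ‖𝓕 (fun v => G (k, v)) v‖ₑ ^ 2 =
      ∫⁻ k : K, ∫⁻ v : V, ‖G (k, v)‖ₑ ^ 2 :=
    lintegral_congr_ae (by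
      filter_upwards [hi] with k hk using lintegral_fourier_sq hk.1 hk.2)
  rw [h2, ← e _ hG.1]
  exact ENNReal.rpow_lt_top_of_nonneg (by norm_num) hG.2.ne

end Slices

/-! ### Densities are determined by their Fourier transforms. -/

section Uniqueness

open Filter Topology

theorem integral_withDensity_ofReal {X : Type*} [MeasurableSpace X] {μ : Measure X} {ρ : X → ℝ}
    (hρ : AEMeasurable ρ μ) (h0 : ∀ x, 0 ≤ ρ x) (φ : X → ℂ) :
    ∫ x, φ x ∂(μ.withDensity fun x => ENNReal.ofReal (ρ x)) = ∫ x, (ρ x : ℂ) * φ x ∂μ := by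
  rw [integral_withDensity_eq_integral_toReal_smul₀ hρ.ennreal_ofReal
    (Eventually.of_forall fun x => ENNReal.ofReal_lt_top)]
  refine integral_congr_ae (Eventually.of_forall fun x => ?_)
  simp only [ENNReal.toReal_ofReal (h0 x), Complex.real_smul]

/-- Nonnegative integrable densities with the same Fourier transform agree almost everywhere. -/
theorem ae_eq_of_fourier_density_eq {X : Type*} [NormedAddCommGroup X] [NormedSpace ℝ X]
    [FiniteDimensional ℝ X] [MeasurableSpace X] [BorelSpace X] {μ : Measure X}
    {ρ σ : X → ℝ} (hρ : Integrable ρ μ) (hσ : Integrable σ μ) (hρ0 : ∀ x, 0 ≤ ρ x)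
    (hσ0 : ∀ x, 0 ≤ σ x)
    (h : ∀ ℓ : StrongDual ℝ X, ∫ x, (ρ x : ℂ) * Complex.exp (ℓ x * Complex.I) ∂μ =
      ∫ x, (σ x : ℂ) * Complex.exp (ℓ x * Complex.I) ∂μ) : ρ =ᵐ[μ] σ := by
  have := FiniteDimensional.complete ℝ X
  have := FiniteDimensional.proper_real X
  have h1 := isFiniteMeasure_withDensity_ofReal hρ.2
  have h2 := isFiniteMeasure_withDensity_ofReal hσ.2
  have heq : (μ.withDensity fun x => ENNReal.ofReal (ρ x)) =
      μ.withDensity fun x => ENNReal.ofReal (σ x) := by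
    refine Measure.ext_of_charFunDual (funext fun ℓ => ?_)
    rw [charFunDual_apply, charFunDual_apply, integral_withDensity_ofReal hρ.aemeasurable hρ0,
      integral_withDensity_ofReal hσ.aemeasurable hσ0, h]
  rw [withDensity_eq_iff hρ.aemeasurable.ennreal_ofReal hσ.aemeasurable.ennreal_ofReal
    hρ.lintegral_lt_top.ne] at heq
  filter_upwards [heq] with x hx
  exact (ENNReal.ofReal_eq_ofReal_iff (hρ0 x) (hσ0 x)).1 hx

end Uniqueness

/-! ### From the autocorrelation identity to Hardy's theorem on slices. -/

section Slices

open Filter Topology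
open scoped FourierTransform

variable {K V : Type*} [NormedAddCommGroup V] [InnerProductSpace ℝ V] [FiniteDimensional ℝ V]
  [MeasurableSpace V] [BorelSpace V] [NormedAddCommGroup K] [InnerProductSpace ℝ K]
  [FiniteDimensional ℝ K] [MeasurableSpace K] [BorelSpace K]

theorem exists_dual_prod {K V : Type*} [NormedAddCommGroup V] [InnerProductSpace ℝ V]
    [FiniteDimensional ℝ V] [NormedAddCommGroup K] [InnerProductSpace ℝ K] [FiniteDimensional ℝ K]
    (ℓ : StrongDual ℝ (K × V)) :
    ∃ (b : K) (a : V), ∀ p : K × V, ℓ p = 2 * Real.pi * (inner ℝ b p.1 + inner ℝ a p.2) := by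
  have := FiniteDimensional.complete ℝ K
  have := FiniteDimensional.complete ℝ V
  refine ⟨(2 * Real.pi)⁻¹ • (InnerProductSpace.toDual ℝ K).symm (ℓ.comp (.inl ℝ K V)),
    (2 * Real.pi)⁻¹ • (InnerProductSpace.toDual ℝ V).symm (ℓ.comp (.inr ℝ K V)), fun p => ?_⟩
  rw [real_inner_smul_left, real_inner_smul_left, InnerProductSpace.toDual_symm_apply,
    InnerProductSpace.toDual_symm_apply, ← mul_add, ← mul_assoc,
    mul_inv_cancel₀ (by positivity), one_mul]
  simp only [ContinuousLinearMap.comp_apply, ContinuousLinearMap.inl_apply,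
    ContinuousLinearMap.inr_apply, ← map_add]
  simp

variable {G H : K × V → ℂ}

theorem integrable_mul_exp {X : Type*} [TopologicalSpace X] [SecondCountableTopology X]
    [MeasurableSpace X] [BorelSpace X]
    {μ : Measure X} {φ : X → ℂ} (hφ : Integrable φ μ) {θ : X → ℝ} (hθ : Continuous θ) :
    Integrable (fun x => φ x * Complex.exp (2 * Real.pi * Complex.I * θ x)) μ := by
  refine hφ.mul_bdd (c := 1) (Continuous.aestronglyMeasurable (by fun_prop)) ?_
  refine Eventually.of_forall fun x => ?_
  rw [show 2 * (Real.pi : ℂ) * Complex.I * θ x = ((2 * Real.pi * θ x : ℝ) : ℂ) * Complex.I by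
    push_cast; ring, Complex.norm_exp_ofReal_mul_I]

/-- If the Fourier transform of `c |H|²` is the partial autocorrelation of `G`, then `c |H|²` is
the square of the partial Fourier transform of `G`. -/
theorem ae_normSq_eq_partial_fourier
    (hG : MemLp G 2 ((volume : Measure K).prod (volume : Measure V)))
    (hH : MemLp H 2 ((volume : Measure K).prod (volume : Measure V)))
    (hi : ∀ᵐ k : K, Integrable (fun v => G (k, v)) ∧ MemLp (fun v => G (k, v)) 2)
    {c : ℝ} (hc : 0 ≤ c)
    (hid : ∀ (b : K) (a : V),
      c * ∫ p, ((‖H p‖ ^ 2 : ℝ) : ℂ) * Complex.exp (2 * Real.pi * Complex.I *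
        ((inner ℝ b p.1 + inner ℝ a p.2 : ℝ) : ℂ))
          ∂((volume : Measure K).prod (volume : Measure V)) =
      ∫ p, (starRingEnd ℂ (G p) * G (p.1, p.2 + a)) * Complex.exp (2 * Real.pi * Complex.I *
        (inner ℝ b p.1 : ℝ)) ∂((volume : Measure K).prod (volume : Measure V))) :
    ∀ᵐ k : K, ∀ᵐ u : V, c * ‖H (k, u)‖ ^ 2 = ‖𝓕 (fun v => G (k, v)) u‖ ^ 2 := by
  have hF := memLp_partial_fourier hG hi
  have hF2 := (memLp_two_iff_integrable_sq_norm hF.1).1 hF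
  have hH2 := (memLp_two_iff_integrable_sq_norm hH.1).1 hH
  have key := ae_eq_of_fourier_density_eq (hH2.const_mul c) hF2 (fun p => by positivity)
    (fun p => by positivity) fun ℓ => ?_
  · exact Measure.ae_ae_of_ae_prod key
  obtain ⟨b, a, hℓ⟩ := exists_dual_prod ℓ
  have hexp : ∀ p : K × V, Complex.exp ((ℓ p : ℂ) * Complex.I) =
      Complex.exp (2 * Real.pi * Complex.I * ((inner ℝ b p.1 + inner ℝ a p.2 : ℝ) : ℂ)) := by
    intro p
    rw [hℓ]; congr 1; push_cast; ring
  simp only [hexp]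
  have hL : ∫ p : K × V, ((c * ‖H p‖ ^ 2 : ℝ) : ℂ) * Complex.exp (2 * Real.pi * Complex.I *
        ((inner ℝ b p.1 + inner ℝ a p.2 : ℝ) : ℂ))
          ∂((volume : Measure K).prod (volume : Measure V)) =
      c * ∫ p, ((‖H p‖ ^ 2 : ℝ) : ℂ) * Complex.exp (2 * Real.pi * Complex.I *
        ((inner ℝ b p.1 + inner ℝ a p.2 : ℝ) : ℂ))
          ∂((volume : Measure K).prod (volume : Measure V)) := by
    rw [← integral_const_mul]
    refine integral_congr_ae (Eventually.of_forall fun p => ?_)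
    simp only [Complex.ofReal_mul, mul_assoc]
  rw [hL, hid]
  have hshift : MeasurePreserving (fun p : K × V => (p.1, p.2 + a))
      ((volume : Measure K).prod (volume : Measure V))
      ((volume : Measure K).prod (volume : Measure V)) :=
    (MeasurePreserving.id _).prod (measurePreserving_add_right _ a)
  have hGG : Integrable (fun p : K × V => starRingEnd ℂ (G p) * G (p.1, p.2 + a))
      ((volume : Measure K).prod (volume : Measure V)) :=
    MemLp.integrable_mul (p := 2) (q := 2) hG.star (hG.comp_measurePreserving hshift)
  have hF2c : Integrable (fun p : K × V => ((‖𝓕 (fun v => G (p.1, v)) p.2‖ ^ 2 : ℝ) : ℂ))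
      ((volume : Measure K).prod (volume : Measure V)) := hF2.ofReal
  rw [integral_prod _ (integrable_mul_exp hGG (by fun_prop)),
    integral_prod _ (integrable_mul_exp hF2c (by fun_prop))]
  refine integral_congr_ae ?_
  -- For fixed k the autocorrelation in v is the inverse transform of the squared modulus of the
  -- slice's transform; the character in k is a constant factor.
  filter_upwards [hi] with k hk
  have hP := integral_normSq_fourier_mul_exp hk.1 hk.2 a
  rw [integral_mul_const, ← hP, ← integral_mul_const]
  refine integral_congr_ae (Eventually.of_forall fun u => ?_)
  simp only
  rw [mul_assoc, ← Complex.exp_add]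
  congr 2
  push_cast
  ring

variable (L : V ≃L[ℝ] V)

/-- The bound on H passes to the transform of the slice only almost everywhere; it holds everywhere
because that transform is continuous. -/
theorem ae_forall_fourier_bound
    (hG : MemLp G 2 ((volume : Measure K).prod (volume : Measure V)))
    (hGdec : ∀ᵐ k : K, ∃ α : ℝ, ∀ᵐ v : V, ‖G (k, v)‖ ≤ α * Real.exp (-Real.pi * ‖L v‖ ^ 2))
    (P : V →ₗ[ℝ] V)
    (hHdec : ∀ᵐ k : K, ∃ β : ℝ, ∀ᵐ u : V,
      ‖H (k, u)‖ ≤ β * Real.exp (-Real.pi * inner ℝ (P u) u))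
    {c : ℝ} (hc : 0 ≤ c)
    (hHG : ∀ᵐ k : K, ∀ᵐ u : V, c * ‖H (k, u)‖ ^ 2 = ‖𝓕 (fun v => G (k, v)) u‖ ^ 2) :
    ∀ᵐ k : K, AEStronglyMeasurable (fun v => G (k, v)) volume ∧
      ∃ α β : ℝ, (∀ᵐ v : V, ‖G (k, v)‖ ≤ α * Real.exp (-Real.pi * ‖L v‖ ^ 2)) ∧
      ∀ u, ‖𝓕 (fun v => G (k, v)) u‖ ≤ β * Real.exp (-Real.pi * inner ℝ (P u) u) := by
  filter_upwards [hG.1.prodMk_left, hGdec, hHdec, hHG] with k hm ⟨α, hα⟩ ⟨β, hβ⟩ hk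
  refine ⟨hm, α, Real.sqrt c * β, hα, ?_⟩
  have hint := (integrable_of_gaussian_bound_comp L hm hα).1
  refine forall_le_of_ae_le (continuous_fourier_of_integrable hint).norm ?_ ?_
  · have : Continuous P := P.continuous_of_finiteDimensional
    fun_prop
  · filter_upwards [hβ, hk] with u h1 h2
    have h3 : ‖𝓕 (fun v => G (k, v)) u‖ = Real.sqrt c * ‖H (k, u)‖ := by
      rw [← Real.sqrt_sq (norm_nonneg (𝓕 (fun v => G (k, v)) u)), ← h2, Real.sqrt_mul hc,
        Real.sqrt_sq (norm_nonneg _)]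
    rw [h3, mul_assoc]
    exact mul_le_mul_of_nonneg_left h1 (Real.sqrt_nonneg _)

theorem slices_eq_zero (hL : ∀ x y, inner ℝ (L x) y = inner ℝ x (L y)) (P : V →ₗ[ℝ] V)
    (hG : AEStronglyMeasurable G ((volume : Measure K).prod (volume : Measure V)))
    (hdec : ∀ᵐ k : K, AEStronglyMeasurable (fun v => G (k, v)) volume ∧
      ∃ α β : ℝ, (∀ᵐ v : V, ‖G (k, v)‖ ≤ α * Real.exp (-Real.pi * ‖L v‖ ^ 2)) ∧
      ∀ u, ‖𝓕 (fun v => G (k, v)) u‖ ≤ β * Real.exp (-Real.pi * inner ℝ (P u) u))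
    {w : V} (hw : ‖w‖ ^ 2 < inner ℝ (P (L w)) (L w)) :
    G =ᵐ[(volume : Measure K).prod (volume : Measure V)] 0 := by
  have h : ∀ᵐ k : K, ∀ᵐ v : V, G (k, v) = 0 := by
    filter_upwards [hdec] with k ⟨hm, α, β, h1, h2⟩
    exact hardy_le L hL hm h1 P h2 hw
  -- Passing from slices back to the product needs a measurable zero set, hence the measurable
  -- representative.
  have h1 : ∀ᵐ k : K, ∀ᵐ v : V, hG.mk G (k, v) = 0 := by
    filter_upwards [h, Measure.ae_ae_of_ae_prod hG.ae_eq_mk] with k h1 h2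
    filter_upwards [h1, h2] with v h3 h4
    rw [← h4, h3]
  refine hG.ae_eq_mk.trans ?_
  exact (Measure.ae_prod_iff_ae_ae
    (measurableSet_eq_fun hG.stronglyMeasurable_mk.measurable measurable_const)).2 h1

theorem slices_eq_gaussian (hL : ∀ x y, inner ℝ (L x) y = inner ℝ x (L y)) (P : V →ₗ[ℝ] V)
    (hG : MemLp G 2 ((volume : Measure K).prod (volume : Measure V)))
    (hdec : ∀ᵐ k : K, AEStronglyMeasurable (fun v => G (k, v)) volume ∧
      ∃ α β : ℝ, (∀ᵐ v : V, ‖G (k, v)‖ ≤ α * Real.exp (-Real.pi * ‖L v‖ ^ 2)) ∧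
      ∀ u, ‖𝓕 (fun v => G (k, v)) u‖ ≤ β * Real.exp (-Real.pi * inner ℝ (P u) u))
    (hP : ∀ w, inner ℝ (P (L w)) (L w) = ‖w‖ ^ 2) :
    ∃ γ : K → ℂ, MemLp γ 2 volume ∧
      ∀ᵐ k : K, ∀ᵐ v : V, G (k, v) = γ k * Complex.exp (-Real.pi * ‖L v‖ ^ 2) := by
  -- The coefficient from `hardy_eq`, an integral in v, so its measurability in k is automatic.
  set γ : K → ℂ := fun k => ∫ y, G (k, L.symm y) with hγ
  have heq : ∀ᵐ k : K, ∀ᵐ v : V, G (k, v) = γ k * Complex.exp (-Real.pi * ‖L v‖ ^ 2) := by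
    filter_upwards [hdec] with k ⟨hm, α, β, h1, h2⟩
    exact hardy_eq L hL hm h1 P h2 hP
  have hγm : AEStronglyMeasurable γ volume := by
    refine AEStronglyMeasurable.integral_prod_right' (μ := (volume : Measure K))
      (ν := (volume : Measure V)) (f := fun p : K × V => G (p.1, L.symm p.2)) ?_
    exact hG.1.comp_quasiMeasurePreserving (QuasiMeasurePreserving.prodMap
      (Measure.QuasiMeasurePreserving.id _)
      (quasiMeasurePreserving_linearEquiv L.symm volume volume))
  refine ⟨γ, ⟨hγm, ?_⟩, heq⟩
  -- By Tonelli the squared norm of G is κ times that of γ, so κ ≠ 0 suffices for γ to be in L².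
  · set κ : ℝ≥0∞ := ∫⁻ v : V, ‖Complex.exp (-Real.pi * ‖L v‖ ^ 2)‖ₑ ^ 2 with hκ
    have hκ0 : κ ≠ 0 := by
      have hc : Continuous fun v : V => ‖Complex.exp (-Real.pi * ‖L v‖ ^ 2)‖ₑ ^ 2 := by
        have : Continuous fun v : V => Complex.exp (-Real.pi * ‖L v‖ ^ 2) := by fun_prop
        exact (ENNReal.continuous_pow 2).comp this.enorm
      rw [hκ, Ne, lintegral_eq_zero_iff hc.measurable]
      intro h
      obtain ⟨v, hv⟩ := h.exists
      simp at hv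
    have h1 : ∫⁻ k, ∫⁻ v, ‖G (k, v)‖ₑ ^ 2 = (∫⁻ k, ‖γ k‖ₑ ^ 2) * κ := by
      have h2 : ∫⁻ k, ∫⁻ v, ‖G (k, v)‖ₑ ^ 2 = ∫⁻ k, ‖γ k‖ₑ ^ 2 * κ := by
        refine lintegral_congr_ae ?_
        filter_upwards [heq] with k hk
        rw [hκ, ← lintegral_const_mul' _ _ (by simp)]
        refine lintegral_congr_ae ?_
        filter_upwards [hk] with v hv
        rw [hv, enorm_mul, mul_pow]
      rw [h2, lintegral_mul_const'' _ (hγm.enorm.pow_const 2)]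
    have h3 := eLpNorm_nnreal_pow_eq_lintegral
      (μ := (volume : Measure K).prod (volume : Measure V)) (f := G) (p := 2) (by simp)
    have h4 := eLpNorm_nnreal_pow_eq_lintegral (μ := (volume : Measure K)) (f := γ) (p := 2)
      (by simp)
    simp only [ENNReal.coe_ofNat, NNReal.coe_ofNat, ENNReal.rpow_ofNat] at h3 h4
    rw [lintegral_prod _ (hG.1.enorm.pow_const 2), h1, ← h4] at h3
    have h5 : eLpNorm γ 2 volume ^ 2 * κ < ∞ := by
      rw [← h3]; exact ENNReal.pow_lt_top hG.2
    by_contra h6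
    rw [not_lt_top_iff.1 h6] at h5
    simp [ENNReal.top_mul hκ0] at h5

end Slices

/-! ### Phase-space reflections and metaplectic covariance. -/

section Parity

open Filter Topology

variable {d : ℕ}

theorem memLp_parity (z : Rd d × Rd d) (h : L2 d) :
    MemLp (fun y : Rd d => Complex.exp (4 * Real.pi * Complex.I * (inner ℝ z.2 (y - z.1) : ℝ)) *
      h ((2 : ℝ) • z.1 - y)) 2 volume := by
  have hm : MemLp (fun y : Rd d => h ((2 : ℝ) • z.1 - y)) 2 volume :=
    (Lp.memLp h).comp_measurePreserving (Measure.measurePreserving_sub_left volume ((2 : ℝ) • z.1))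
  have hc : Continuous fun y : Rd d =>
      Complex.exp (4 * Real.pi * Complex.I * (inner ℝ z.2 (y - z.1) : ℝ)) := by fun_prop
  refine hm.of_le (hc.aestronglyMeasurable.mul hm.1) (Eventually.of_forall fun y => ?_)
  rw [norm_mul, show 4 * (Real.pi : ℂ) * Complex.I * (inner ℝ z.2 (y - z.1) : ℝ) =
    ((4 * Real.pi * inner ℝ z.2 (y - z.1) : ℝ) : ℂ) * Complex.I by push_cast; ring,
    Complex.norm_exp_ofReal_mul_I, one_mul]

/-- The parity operator about the point `z` of phase space. -/
noncomputable def parity (z : Rd d × Rd d) (h : L2 d) : L2 d := (memLp_parity z h).toLp _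

theorem coeFn_parity (z : Rd d × Rd d) (h : L2 d) :
    parity z h =ᵐ[volume] fun y : Rd d =>
      Complex.exp (4 * Real.pi * Complex.I * (inner ℝ z.2 (y - z.1) : ℝ)) *
        h ((2 : ℝ) • z.1 - y) := (memLp_parity z h).coeFn_toLp

theorem conj_exp_four_pi (t : ℝ) : starRingEnd ℂ (Complex.exp (4 * Real.pi * Complex.I * t)) =
    Complex.exp (-(4 * Real.pi * Complex.I * t)) := by
  rw [← Complex.exp_conj, show 4 * (Real.pi : ℂ) * Complex.I * t =
    ((4 * Real.pi * t : ℝ) : ℂ) * Complex.I by push_cast; ring, map_mul, Complex.conj_ofReal,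
    Complex.conj_I, mul_neg]

/-- The Wigner distribution is, up to a constant, a matrix coefficient of the parity operators. -/
theorem wigner_eq_inner_parity (h g : L2 d) (z : Rd d × Rd d) :
    wigner h g z = (2 : ℂ) ^ d * inner ℂ (parity z g) h := by
  set Φ : Rd d → ℂ := fun y => h y * starRingEnd ℂ (g ((2 : ℝ) • z.1 - y)) *
    Complex.exp (-(4 * Real.pi * Complex.I * (inner ℝ z.2 (y - z.1) : ℝ))) with hΦ
  have h1 : inner ℂ (parity z g) h = ∫ y, Φ y := by
    rw [L2.inner_def]
    refine integral_congr_ae ?_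
    filter_upwards [coeFn_parity z g] with y hy
    rw [hy, RCLike.inner_apply, map_mul, conj_exp_four_pi, hΦ]
    ring
  have h2 : wigner h g z = ∫ t : Rd d, Φ (z.1 + (2⁻¹ : ℝ) • t) := by
    rw [wigner]
    refine integral_congr_ae (Eventually.of_forall fun t => ?_)
    simp only [hΦ]
    rw [show (2 : ℝ) • z.1 - (z.1 + (2⁻¹ : ℝ) • t) = z.1 - (2⁻¹ : ℝ) • t by
      rw [two_smul]; abel, add_sub_cancel_left, real_inner_smul_right]
    congr 3
    push_cast
    ring
  rw [h1, h2, Measure.integral_comp_smul volume (fun t : Rd d => Φ (z.1 + t)) (2⁻¹ : ℝ),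
    integral_add_left_eq_self]
  rw [finrank_euclideanSpace_fin, abs_of_pos (by positivity), inv_pow, inv_inv, Complex.real_smul]
  push_cast
  rfl

/-- Covariance for every pair is an identity of matrix coefficients, and surjectivity of T lets the
second vector range over all of L². -/
theorem IsMetaplectic.map_parity {S : Matrix (Fin d ⊕ Fin d) (Fin d ⊕ Fin d) ℝ}
    {T : L2 d ≃ₗᵢ[ℂ] L2 d} (hT : IsMetaplectic S T) (z : Rd d × Rd d) (g : L2 d) :
    T (parity (blockAct S⁻¹ z) g) = parity z (T g) := by
  refine ext_inner_right ℂ fun v => ?_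
  obtain ⟨h, rfl⟩ := T.surjective v
  have h1 := hT.covariance h g z
  rw [wigner_eq_inner_parity, wigner_eq_inner_parity] at h1
  rw [T.inner_map_map]
  exact (mul_left_cancel₀ (pow_ne_zero _ two_ne_zero) h1).symm

/-- The product of two reflections is a phase-space translation by twice the difference of their
centres; hence a modulated autocorrelation. -/
theorem inner_parity_parity_zero (f : L2 d) (z : Rd d × Rd d) :
    inner ℂ (parity z f) (parity 0 f) = ∫ y : Rd d, starRingEnd ℂ (f y) * f (y - (2 : ℝ) • z.1) *
      Complex.exp (4 * Real.pi * Complex.I * (inner ℝ z.2 (y - z.1) : ℝ)) := by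
  set Φ : Rd d → ℂ := fun y => starRingEnd ℂ (f y) * f (y - (2 : ℝ) • z.1) *
      Complex.exp (4 * Real.pi * Complex.I * (inner ℝ z.2 (y - z.1) : ℝ)) with hΦ
  rw [← integral_sub_left_eq_self Φ volume ((2 : ℝ) • z.1), L2.inner_def]
  refine integral_congr_ae ?_
  filter_upwards [coeFn_parity z f, coeFn_parity 0 f] with y h1 h2
  rw [h1, h2, RCLike.inner_apply, map_mul, conj_exp_four_pi]
  simp only [hΦ, Prod.fst_zero, Prod.snd_zero, inner_zero_left, smul_zero, zero_sub]
  rw [show (2 : ℝ) • z.1 - y - (2 : ℝ) • z.1 = -y by abel,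
    show (2 : ℝ) • z.1 - y - z.1 = -(y - z.1) by rw [two_smul]; abel, inner_neg_right]
  simp only [Complex.ofReal_zero, mul_zero, Complex.exp_zero, one_mul, Complex.ofReal_neg,
    mul_neg]
  ring

theorem blockAct_zero (S : Matrix (Fin d ⊕ Fin d) (Fin d ⊕ Fin d) ℝ) :
    blockAct S (0 : Rd d × Rd d) = 0 := by
  simp [blockAct]

theorem symplectic_inv_fromBlocks {A B C D : Matrix (Fin d) (Fin d) ℝ}
    (hS : Matrix.fromBlocks A B C D ∈ Matrix.symplecticGroup (Fin d) ℝ) :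
    (Matrix.fromBlocks A B C D)⁻¹ = Matrix.fromBlocks Dᵀ (-Bᵀ) (-Cᵀ) Aᵀ := by
  have h := SymplecticGroup.inv_eq_symplectic_inv _ hS
  rw [h, Matrix.J, Matrix.fromBlocks_transpose, Matrix.fromBlocks_neg, Matrix.fromBlocks_multiply,
    Matrix.fromBlocks_multiply]
  simp

/-- The Fourier transform of `|T f|²`, in terms of `f`. -/
theorem IsMetaplectic.integral_normSq_mul_exp {A B C D : Matrix (Fin d) (Fin d) ℝ}
    {T : L2 d ≃ₗᵢ[ℂ] L2 d} (hT : IsMetaplectic (Matrix.fromBlocks A B C D) T) (f : L2 d)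
    (ξ : Rd d) :
    ∫ y : Rd d, ((‖T f y‖ ^ 2 : ℝ) : ℂ) *
        Complex.exp (2 * Real.pi * Complex.I * (inner ℝ ξ y : ℝ)) =
      ∫ y : Rd d, starRingEnd ℂ (f y) * f (y + act Bᵀ ξ) *
        Complex.exp (2 * Real.pi * Complex.I *
          (inner ℝ (act Aᵀ ξ) (y + (2⁻¹ : ℝ) • act Bᵀ ξ) : ℝ)) := by
  -- A purely frequency centre, so no translation acts on T f and |T f|² appears; the half
  -- compensates the doubling.
  set z : Rd d × Rd d := (0, (2⁻¹ : ℝ) • ξ) with hz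
  have h1 : inner ℂ (parity z (T f)) (parity 0 (T f)) =
      inner ℂ (parity (blockAct (Matrix.fromBlocks A B C D)⁻¹ z) f) (parity 0 f) := by
    rw [← hT.map_parity z f, ← hT.map_parity 0 f, blockAct_zero, T.inner_map_map]
  have hz' : blockAct (Matrix.fromBlocks A B C D)⁻¹ z =
      (-((2⁻¹ : ℝ) • act Bᵀ ξ), (2⁻¹ : ℝ) • act Aᵀ ξ) := by
    rw [symplectic_inv_fromBlocks hT.symplectic]
    simp [blockAct, hz]
  rw [inner_parity_parity_zero, inner_parity_parity_zero, hz'] at h1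
  refine Eq.trans ?_ (h1.trans ?_)
  · refine integral_congr_ae (Eventually.of_forall fun y => ?_)
    simp only [hz, smul_zero, sub_zero, real_inner_smul_left]
    rw [mul_comm (starRingEnd ℂ _), Complex.mul_conj, Complex.normSq_eq_norm_sq]
    congr 2
    push_cast
    ring
  · refine integral_congr_ae (Eventually.of_forall fun y => ?_)
    simp only [smul_neg, sub_neg_eq_add, smul_smul, real_inner_smul_left]
    norm_num
    left
    congr 1
    ring

end Parity

/-! ### Kernels, ranges and the spectrum of M Bᵀ N B. -/

section LinearAlgebra

variable {d : ℕ}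

theorem act_mul (E F : Matrix (Fin d) (Fin d) ℝ) (x : Rd d) :
    act (E * F) x = act E (act F x) := by
  rw [act, act, act, Matrix.toEuclideanLin, Matrix.toLpLin_mul 2 2 2]; rfl

theorem act_add (E F : Matrix (Fin d) (Fin d) ℝ) (x : Rd d) :
    act (E + F) x = act E x + act F x := by
  rw [act, act, act, map_add, LinearMap.add_apply]

theorem act_one (x : Rd d) : act (1 : Matrix (Fin d) (Fin d) ℝ) x = x := by
  simp [act]

theorem adjoint_act (E : Matrix (Fin d) (Fin d) ℝ) : LinearMap.adjoint (act E) = act Eᵀ := by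
  rw [← Matrix.conjTranspose_eq_transpose_of_trivial]
  exact (Matrix.toEuclideanLin_conjTranspose_eq_adjoint E).symm

theorem inner_act_transpose (E : Matrix (Fin d) (Fin d) ℝ) (x y : Rd d) :
    inner ℝ (act Eᵀ x) y = inner ℝ x (act E y) := by
  rw [← adjoint_act, LinearMap.adjoint_inner_left]

theorem orthogonal_kerM (E : Matrix (Fin d) (Fin d) ℝ) : (kerM E)ᗮ = ranM Eᵀ := by
  rw [kerM, LinearMap.orthogonal_ker, adjoint_act]

theorem orthogonal_ranM (E : Matrix (Fin d) (Fin d) ℝ) : (ranM E)ᗮ = kerM Eᵀ := by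
  rw [← (kerM Eᵀ).orthogonal_orthogonal, orthogonal_kerM, Matrix.transpose_transpose]

theorem rank_eq_finrank_ranM (E : Matrix (Fin d) (Fin d) ℝ) :
    E.rank = Module.finrank ℝ (ranM E) :=
  E.rank_eq_finrank_range_toLin (EuclideanSpace.basisFun (Fin d) ℝ).toBasis
    (EuclideanSpace.basisFun (Fin d) ℝ).toBasis

theorem rank_eq_of_kerM_eq {E F : Matrix (Fin d) (Fin d) ℝ} (h : kerM E = kerM F) :
    E.rank = F.rank := by
  have h1 := LinearMap.finrank_range_add_finrank_ker (act E)
  have h2 := LinearMap.finrank_range_add_finrank_ker (act F)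
  rw [rank_eq_finrank_ranM, rank_eq_finrank_ranM]
  have h3 : Module.finrank ℝ (LinearMap.ker (act E)) =
      Module.finrank ℝ (LinearMap.ker (act F)) := by
    rw [show LinearMap.ker (act E) = LinearMap.ker (act F) from h]
  change Module.finrank ℝ (LinearMap.range (act E)) = Module.finrank ℝ (LinearMap.range (act F))
  omega

theorem inner_act_eq_dotProduct (E : Matrix (Fin d) (Fin d) ℝ) (x : Rd d) :
    inner ℝ (act E x) x = star x.ofLp ⬝ᵥ E *ᵥ x.ofLp := by
  rw [act, Matrix.toLpLin_apply, EuclideanSpace.inner_eq_star_dotProduct]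
  simp

theorem act_eq_zero_of_inner_eq_zero {E : Matrix (Fin d) (Fin d) ℝ} (hE : E.PosSemidef) {x : Rd d}
    (h : inner ℝ (act E x) x = 0) : act E x = 0 := by
  rw [inner_act_eq_dotProduct, hE.dotProduct_mulVec_zero_iff] at h
  rw [act, Matrix.toLpLin_apply, h]; rfl

theorem exists_symm_sqrt {M : Matrix (Fin d) (Fin d) ℝ} (hM : M.PosSemidef) :
    ∃ R : Matrix (Fin d) (Fin d) ℝ, Rᵀ = R ∧ R * R = M := by
  open scoped MatrixOrder in
  refine ⟨CFC.sqrt M, ?_, CFC.sqrt_mul_sqrt_self M hM.nonneg⟩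
  open scoped MatrixOrder in
  exact (Matrix.conjTranspose_eq_transpose_of_trivial _).symm.trans
    (Matrix.nonneg_iff_posSemidef.1 (CFC.sqrt_nonneg M)).isHermitian

/-- If RPRw = 0 then ⟨PRw, Rw⟩ = 0, so PRw = 0 by positivity; powers of the symmetric R all have the
same kernel. -/
theorem kerM_sandwich {R P : Matrix (Fin d) (Fin d) ℝ} (hR : Rᵀ = R) (hP : P.PosSemidef)
    (hK : kerM (R * R) = kerM P) : kerM (R * P * R) = kerM P := by
  ext w
  have hPR : w ∈ kerM P ↔ act R (act R w) = 0 := by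
    rw [← hK, LinearMap.mem_ker, act_mul]
  constructor
  · intro h
    rw [LinearMap.mem_ker, act_mul, act_mul] at h
    have h1 : inner ℝ (act P (act R w)) (act R w) = 0 := by
      have := inner_act_transpose R (act P (act R w)) w
      rw [← this, hR, h, inner_zero_left]
    have h2 : act R w ∈ kerM P := act_eq_zero_of_inner_eq_zero hP h1
    rw [← hK, LinearMap.mem_ker, act_mul] at h2
    have h3 : ∀ y, act R (act R y) = 0 → act R y = 0 := fun y hy => by
      have := inner_act_transpose R (act R y) y
      rw [hR, hy, inner_zero_left] at this
      exact inner_self_eq_zero.1 this.symm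
    rw [hPR]
    exact h3 _ h2
  · intro h
    have h1 := hPR.1 h
    have h2 : act R w = 0 := by
      have := inner_act_transpose R (act R w) w
      rw [hR, h1, inner_zero_left] at this
      exact inner_self_eq_zero.1 this.symm
    rw [LinearMap.mem_ker, act_mul, h2, map_zero]

/-- R(RP) and (RP)R have the same characteristic polynomial, and the second matrix is symmetric. -/
theorem nonzeroEigenvalues_eq {R P : Matrix (Fin d) (Fin d) ℝ} (hG : (R * P * R).IsHermitian) :
    nonzeroEigenvalues (R * R * P) =
      (Finset.univ.val.map hG.eigenvalues).filter (fun t => t ≠ 0) := by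
  rw [nonzeroEigenvalues, Matrix.mul_assoc, Matrix.charpoly_mul_comm,
    hG.roots_charpoly_eq_eigenvalues]
  rfl

theorem act_eigenvectorBasis {E : Matrix (Fin d) (Fin d) ℝ} (hE : E.IsHermitian) (i : Fin d) :
    act E (hE.eigenvectorBasis i) = hE.eigenvalues i • hE.eigenvectorBasis i := by
  rw [act, Matrix.toLpLin_apply, hE.mulVec_eigenvectorBasis]; rfl

variable {R P : Matrix (Fin d) (Fin d) ℝ}

theorem isHermitian_sandwich (hR : Rᵀ = R) (hP : P.PosSemidef) : (R * P * R).IsHermitian := by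
  have h := Matrix.isHermitian_mul_mul_conjTranspose R hP.isHermitian
  rwa [Matrix.conjTranspose_eq_transpose_of_trivial, hR] at h

theorem card_nonzeroEigenvalues (hR : Rᵀ = R) (hP : P.PosSemidef)
    (hK : kerM (R * R) = kerM P) : (nonzeroEigenvalues (R * R * P)).card = P.rank := by
  have hG := isHermitian_sandwich hR hP
  rw [nonzeroEigenvalues_eq hG, ← rank_eq_of_kerM_eq (kerM_sandwich hR hP hK),
    hG.rank_eq_card_non_zero_eigs, Multiset.filter_map, Multiset.card_map, Fintype.card_subtype]
  rfl

theorem exists_of_mem_nonzeroEigenvalues (hR : Rᵀ = R) (hP : P.PosSemidef)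
    (hK : kerM (R * R) = kerM P) {μ : ℝ} (hμ : μ ∈ nonzeroEigenvalues (R * R * P)) :
    ∃ w ∈ (kerM P)ᗮ, w ≠ 0 ∧ inner ℝ (act P (act R w)) (act R w) = μ * ‖w‖ ^ 2 := by
  have hG := isHermitian_sandwich hR hP
  rw [nonzeroEigenvalues_eq hG, Multiset.mem_filter, Multiset.mem_map] at hμ
  obtain ⟨⟨i, -, rfl⟩, hμ0⟩ := hμ
  refine ⟨hG.eigenvectorBasis i, ?_, hG.eigenvectorBasis.orthonormal.ne_zero i, ?_⟩
  -- An eigenvector with non-zero eigenvalue lies in the range of the symmetric matrix, which is the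
  -- orthogonal complement of its kernel.
  · rw [← kerM_sandwich hR hP hK, orthogonal_kerM,
      ← Matrix.conjTranspose_eq_transpose_of_trivial, hG.eq]
    refine ⟨(hG.eigenvalues i)⁻¹ • hG.eigenvectorBasis i, ?_⟩
    rw [map_smul, act_eigenvectorBasis, smul_smul, inv_mul_cancel₀ hμ0, one_smul]
  · have h1 := inner_act_transpose R (act P (act R (hG.eigenvectorBasis i))) (hG.eigenvectorBasis i)
    rw [← h1, hR, ← act_mul, ← act_mul, act_eigenvectorBasis,
      real_inner_smul_left, real_inner_self_eq_norm_sq]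

theorem inner_eq_of_nonzeroEigenvalues_eq_one (hR : Rᵀ = R) (hP : P.PosSemidef)
    (hK : kerM (R * R) = kerM P) (h1 : ∀ μ ∈ nonzeroEigenvalues (R * R * P), μ = 1)
    {w : Rd d} (hw : w ∈ (kerM P)ᗮ) : inner ℝ (act P (act R w)) (act R w) = ‖w‖ ^ 2 := by
  have hG := isHermitian_sandwich hR hP
  have hGT : (R * P * R)ᵀ = R * P * R := by
    rw [← Matrix.conjTranspose_eq_transpose_of_trivial, hG.eq]
  -- With eigenvalues only 0 and 1, RPR is the orthogonal projection onto the complement of ker P.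
  have hfix : act (R * P * R) w = w := by
    refine InnerProductSpace.ext_inner_left_basis hG.eigenvectorBasis.toBasis fun i => ?_
    rw [OrthonormalBasis.coe_toBasis]
    have h2 := inner_act_transpose (R * P * R) (hG.eigenvectorBasis i) w
    rw [← h2, hGT, act_eigenvectorBasis, real_inner_smul_left]
    by_cases h0 : hG.eigenvalues i = 0
    · have hmem : hG.eigenvectorBasis i ∈ kerM P := by
        rw [← kerM_sandwich hR hP hK, LinearMap.mem_ker, act_eigenvectorBasis, h0, zero_smul]
      rw [Submodule.inner_right_of_mem_orthogonal hmem hw, mul_zero]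
    · rw [h1 (hG.eigenvalues i) (by
        rw [nonzeroEigenvalues_eq hG, Multiset.mem_filter, Multiset.mem_map]
        exact ⟨⟨i, Finset.mem_univ i, rfl⟩, h0⟩), one_mul]
  have h3 := inner_act_transpose R (act P (act R w)) w
  rw [← h3, hR, ← act_mul, ← act_mul, hfix, real_inner_self_eq_norm_sq]

/-- Positivity puts Bx in ker N, which is the orthogonal complement of R(N) = R(B), while Bx lies in
R(B). -/
theorem kerM_congr_posSemidef {B N : Matrix (Fin d) (Fin d) ℝ} (hN : N.PosSemidef)
    (hNB : ranM N = ranM B) : kerM (Bᵀ * N * B) = kerM B := by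
  ext x
  rw [LinearMap.mem_ker, LinearMap.mem_ker, act_mul, act_mul]
  constructor
  · intro h
    have h1 : inner ℝ (act N (act B x)) (act B x) = 0 := by
      rw [← inner_act_transpose, h, inner_zero_left]
    have h2 : act B x ∈ kerM N := act_eq_zero_of_inner_eq_zero hN h1
    have hNT : Nᵀ = N := by
      rw [← Matrix.conjTranspose_eq_transpose_of_trivial, hN.isHermitian.eq]
    have h3 : act B x ∈ (ranM B)ᗮ := by rw [← hNB, orthogonal_ranM, hNT]; exact h2
    exact Submodule.disjoint_def.1 (ranM B).orthogonal_disjoint _ ⟨x, rfl⟩ h3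
  · intro h
    rw [h, map_zero, map_zero]

end LinearAlgebra

/-! ### Block relations of a symplectic matrix. -/

section SymplecticBlocks

variable {d : ℕ} {A B C D : Matrix (Fin d) (Fin d) ℝ}

theorem symplectic_blocks (hS : Matrix.fromBlocks A B C D ∈ Matrix.symplecticGroup (Fin d) ℝ) :
    B * Aᵀ = A * Bᵀ ∧ A * Dᵀ = 1 + B * Cᵀ ∧ D * Cᵀ = C * Dᵀ := by
  rw [SymplecticGroup.mem_iff, Matrix.J, Matrix.fromBlocks_transpose, Matrix.fromBlocks_multiply,
    Matrix.fromBlocks_multiply, Matrix.fromBlocks_inj] at hS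
  obtain ⟨h1, h2, -, h4⟩ := hS
  simp only [Matrix.mul_zero, Matrix.mul_one, zero_add, Matrix.mul_neg, add_zero,
    Matrix.neg_mul] at h1 h2 h4
  refine ⟨?_, ?_, ?_⟩
  · rwa [← sub_eq_add_neg, sub_eq_zero] at h1
  · rw [← sub_eq_add_neg, sub_eq_iff_eq_add] at h2
    rw [h2]; abel
  · rwa [← sub_eq_add_neg, sub_eq_zero] at h4

theorem symplectic_blocks_transpose
    (hS : Matrix.fromBlocks A B C D ∈ Matrix.symplecticGroup (Fin d) ℝ) :
    Dᵀ * B = Bᵀ * D ∧ Dᵀ * A = 1 + Bᵀ * C := by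
  have h := SymplecticGroup.transpose_mem hS
  rw [Matrix.fromBlocks_transpose] at h
  obtain ⟨-, h2, h3⟩ := symplectic_blocks h
  simp only [Matrix.transpose_transpose] at h2 h3
  refine ⟨h3, ?_⟩
  have := congrArg Matrix.transpose h2
  simpa [Matrix.transpose_mul, Matrix.transpose_add] using this

end SymplecticBlocks

/-! ### Coordinates on ker B × (ker B)^⊥ and the chirp. -/

section Coordinates

open Filter Topology

variable {d : ℕ} {A B C D : Matrix (Fin d) (Fin d) ℝ}

instance isAddHaarMeasure_leb (W : Submodule ℝ (Rd d)) : (leb W).IsAddHaarMeasure := by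
  unfold leb; infer_instance

theorem mem_orthogonal_kerM_act_transpose (B : Matrix (Fin d) (Fin d) ℝ) (x : Rd d) :
    act Bᵀ x ∈ (kerM B)ᗮ := by
  rw [orthogonal_kerM]; exact ⟨x, rfl⟩

theorem eq_zero_of_mem_kerM_of_mem_orthogonal {x : Rd d} (h : x ∈ kerM B) (h' : x ∈ (kerM B)ᗮ) :
    x = 0 :=
  Submodule.disjoint_def.1 (kerM B).orthogonal_disjoint _ h h'

theorem act_mul_apply_eq_add (hS : Matrix.fromBlocks A B C D ∈ Matrix.symplecticGroup (Fin d) ℝ)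
    (k : Rd d) : act (Dᵀ * A) k = k + act Bᵀ (act C k) := by
  rw [(symplectic_blocks_transpose hS).2, act_add, act_one, act_mul]

/-- Applying Dᵀ, with DᵀA = 1 + BᵀC and DᵀB = BᵀD, exhibits k as an element of R(Bᵀ) = (ker B)^⊥. -/
theorem eq_zero_of_act_add_act_eq_zero
    (hS : Matrix.fromBlocks A B C D ∈ Matrix.symplecticGroup (Fin d) ℝ) {k y : Rd d}
    (hk : k ∈ kerM B) (h : act A k + act B y = 0) : k = 0 := by
  have h1 := congrArg (act Dᵀ) h
  rw [map_add, ← act_mul, ← act_mul, act_mul_apply_eq_add hS, (symplectic_blocks_transpose hS).1,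
    act_mul, map_zero] at h1
  refine eq_zero_of_mem_kerM_of_mem_orthogonal hk ?_
  have h2 : k = -(act Bᵀ (act C k) + act Bᵀ (act D y)) := by
    rw [eq_neg_iff_add_eq_zero, ← add_assoc]; exact h1
  rw [h2]
  exact Submodule.neg_mem _ (Submodule.add_mem _ (mem_orthogonal_kerM_act_transpose B _)
    (mem_orthogonal_kerM_act_transpose B _))

theorem eq_zero_of_act_mul_add_eq_zero
    (hS : Matrix.fromBlocks A B C D ∈ Matrix.symplecticGroup (Fin d) ℝ) {k v : Rd d}
    (hk : k ∈ kerM B) (hv : v ∈ (kerM B)ᗮ) (h : act (Dᵀ * A) k + v = 0) : k = 0 := by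
  rw [act_mul_apply_eq_add hS] at h
  refine eq_zero_of_mem_kerM_of_mem_orthogonal hk ?_
  have h2 : k = -(act Bᵀ (act C k) + v) := by
    rw [eq_neg_iff_add_eq_zero, ← add_assoc]; exact h
  rw [h2]
  exact Submodule.neg_mem _ (Submodule.add_mem _ (mem_orthogonal_kerM_act_transpose B _) hv)

theorem exists_equiv_prod_orthogonal (W : Submodule ℝ (Rd d)) (φ : W →ₗ[ℝ] Rd d)
    (ψ : Wᗮ →ₗ[ℝ] Rd d) (hinj : ∀ k v, φ k + ψ v = 0 → k = 0 ∧ v = 0) :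
    ∃ e : (W × Wᗮ) ≃L[ℝ] Rd d, ∀ p, e p = φ p.1 + ψ p.2 := by
  have hi : Function.Injective (φ.coprod ψ) := by
    rw [← LinearMap.ker_eq_bot, LinearMap.ker_eq_bot']
    rintro ⟨k, v⟩ h
    obtain ⟨rfl, rfl⟩ := hinj k v h
    rfl
  have hd : Module.finrank ℝ (W × Wᗮ) = Module.finrank ℝ (Rd d) := by
    rw [Module.finrank_prod, W.finrank_add_finrank_orthogonal]
  exact ⟨((φ.coprod ψ).linearEquivOfInjective hi hd).toContinuousLinearEquiv, fun p => rfl⟩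

theorem exists_decay_equiv (hS : Matrix.fromBlocks A B C D ∈ Matrix.symplecticGroup (Fin d) ℝ) :
    ∃ e : (kerM B × (kerM B)ᗮ) ≃L[ℝ] Rd d, ∀ p, e p = act (Dᵀ * A) p.1 + p.2 :=
  exists_equiv_prod_orthogonal (kerM B) (act (Dᵀ * A) ∘ₗ (kerM B).subtype) (kerM B)ᗮ.subtype
    fun k v h => by
      have hk : k = 0 := Subtype.ext (eq_zero_of_act_mul_add_eq_zero hS k.2 v.2 h)
      subst hk
      exact ⟨rfl, by simpa using h⟩

theorem exists_range_equiv (hS : Matrix.fromBlocks A B C D ∈ Matrix.symplecticGroup (Fin d) ℝ) :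
    ∃ e : (kerM B × (kerM B)ᗮ) ≃L[ℝ] Rd d, ∀ p, e p = act A p.1 + act B p.2 :=
  exists_equiv_prod_orthogonal (kerM B) (act A ∘ₗ (kerM B).subtype) (act B ∘ₗ (kerM B)ᗮ.subtype)
    fun k v h => by
      have hk : k = 0 := Subtype.ext (eq_zero_of_act_add_act_eq_zero hS k.2 h)
      subst hk
      refine ⟨rfl, Subtype.ext (eq_zero_of_mem_kerM_of_mem_orthogonal ?_ v.2)⟩
      simpa using h

/-- Every character of K × V is read off from a frequency ξ on ℝᵈ, and its V-component is exactly
the shift Bᵀξ of the autocorrelation. -/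
theorem exists_dual_vector {e : (kerM B × (kerM B)ᗮ) ≃L[ℝ] Rd d}
    (he : ∀ p, e p = act A p.1 + act B p.2) (b : kerM B) (a : (kerM B)ᗮ) :
    ∃ ξ : Rd d, (∀ p, inner ℝ ξ (e p) = inner ℝ b p.1 + inner ℝ a p.2) ∧ act Bᵀ ξ = a := by
  set ℓ : StrongDual ℝ (Rd d) :=
    ((innerSL ℝ b).coprod (innerSL ℝ a)).comp e.symm.toContinuousLinearMap with hℓ
  have h1 : ∀ p, inner ℝ ((InnerProductSpace.toDual ℝ (Rd d)).symm ℓ) (e p) =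
      inner ℝ b p.1 + inner ℝ a p.2 := by
    intro p
    rw [InnerProductSpace.toDual_symm_apply, hℓ]
    simp
  refine ⟨_, h1, ?_⟩
  set ξ := (InnerProductSpace.toDual ℝ (Rd d)).symm ℓ
  have h2 : (⟨act Bᵀ ξ, mem_orthogonal_kerM_act_transpose B ξ⟩ : (kerM B)ᗮ) = a := by
    refine ext_inner_right ℝ fun u => ?_
    have h3 := h1 (0, u)
    rw [he] at h3
    simp only [ZeroMemClass.coe_zero, map_zero, zero_add, inner_zero_right] at h3
    rw [← h3, ← inner_act_transpose]
    rfl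
  exact congrArg Subtype.val h2

theorem act_pinv_of_mem {y : Rd d} (hy : y ∈ ranM B) : act B (pinv B y) = y := by
  set e := (act B).kerComplementEquivRange (kerM B).isCompl_orthogonal.symm
  have h1 : ∀ v : (kerM B)ᗮ, act B (v : Rd d) = (e v : Rd d) := fun v => rfl
  have h2 : pinv B y = ((e.symm ((ranM B).orthogonalProjectionOnto y) : (kerM B)ᗮ) : Rd d) := rfl
  rw [h2, h1, LinearEquiv.apply_symm_apply]
  exact congrArg Subtype.val ((ranM B).orthogonalProjectionOnto_mem_subspace_eq_self ⟨y, hy⟩)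

theorem act_mem_ranM (hS : Matrix.fromBlocks A B C D ∈ Matrix.symplecticGroup (Fin d) ℝ)
    {v : Rd d} (hv : v ∈ (kerM B)ᗮ) : act A v ∈ ranM B := by
  rw [orthogonal_kerM] at hv
  obtain ⟨y, rfl⟩ := hv
  rw [← act_mul, ← (symplectic_blocks hS).1, act_mul]
  exact ⟨_, rfl⟩

theorem inner_pinv_act (hS : Matrix.fromBlocks A B C D ∈ Matrix.symplecticGroup (Fin d) ℝ)
    {v : Rd d} (hv : v ∈ (kerM B)ᗮ) (ξ : Rd d) :
    inner ℝ (pinv B (act A v)) (act Bᵀ ξ) = inner ℝ (act Aᵀ ξ) v := by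
  rw [real_inner_comm, inner_act_transpose, act_pinv_of_mem (act_mem_ranM hS hv),
    inner_act_transpose]

/-- With `inner_pinv_act` this expresses the symmetry of B⁺A on (ker B)^⊥, a consequence of BAᵀ =
ABᵀ. -/
theorem inner_pinv_act_comm (hS : Matrix.fromBlocks A B C D ∈ Matrix.symplecticGroup (Fin d) ℝ)
    {v : Rd d} (hv : v ∈ (kerM B)ᗮ) (ξ : Rd d) :
    inner ℝ (pinv B (act A (act Bᵀ ξ))) v = inner ℝ (act Aᵀ ξ) v := by
  have hv' := hv
  rw [orthogonal_kerM] at hv'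
  obtain ⟨y, rfl⟩ := hv'
  rw [inner_pinv_act hS (mem_orthogonal_kerM_act_transpose B ξ), inner_act_transpose,
    inner_act_transpose, ← act_mul, ← act_mul, ← inner_act_transpose, Matrix.transpose_mul,
    Matrix.transpose_transpose, (symplectic_blocks hS).1, real_inner_comm]

/-- The phase that turns the slices of `f` into functions whose Fourier transforms are the slices
of `T f` up to unimodular factors. -/
noncomputable def chirp (A B C : Matrix (Fin d) (Fin d) ℝ) (p : kerM B × (kerM B)ᗮ) : ℝ :=
  inner ℝ (pinv B (act A p.2)) (p.2 : Rd d) + 2 * inner ℝ (act (Cᵀ * A) p.1) (p.2 : Rd d)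

theorem continuous_chirp : Continuous (chirp A B C) := by
  have h1 : Continuous (pinv B ∘ₗ act A) := LinearMap.continuous_of_finiteDimensional _
  have h2 : Continuous (act (Cᵀ * A)) := LinearMap.continuous_of_finiteDimensional _
  have h3 : Continuous fun p : kerM B × (kerM B)ᗮ => (p.2 : Rd d) :=
    continuous_subtype_val.comp continuous_snd
  have h4 : Continuous fun p : kerM B × (kerM B)ᗮ => (p.1 : Rd d) :=
    continuous_subtype_val.comp continuous_fst
  exact ((h1.comp h3).inner h3).add (continuous_const.mul ((h2.comp h4).inner h3))

/-- The quadratic part of the chirp accounts for the phase in v and a; the bilinear part, through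
ADᵀ = 1 + BCᵀ, accounts for the phase in k. -/
theorem chirp_add_sub (hS : Matrix.fromBlocks A B C D ∈ Matrix.symplecticGroup (Fin d) ℝ)
    (k : kerM B) (v a : (kerM B)ᗮ) {ξ : Rd d} (ha : act Bᵀ ξ = a) :
    chirp A B C (k, v + a) - chirp A B C (k, v) + 2 * inner ℝ ξ (act A k) =
      2 * inner ℝ (act Aᵀ ξ) (act (Dᵀ * A) k + v + (2⁻¹ : ℝ) • act Bᵀ ξ) := by
  have h1 := inner_pinv_act hS v.2 ξ
  have h2 := inner_pinv_act_comm hS v.2 ξ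
  have h3 := inner_pinv_act hS (mem_orthogonal_kerM_act_transpose B ξ) ξ
  have h4 : inner ℝ (act Aᵀ ξ) (act (Dᵀ * A) (k : Rd d)) =
      inner ℝ ξ (act A k) + inner ℝ (act (Cᵀ * A) (k : Rd d)) (act Bᵀ ξ) := by
    rw [inner_act_transpose, act_mul, ← act_mul, (symplectic_blocks hS).2.1, act_add,
      act_one, inner_add_right, act_mul, act_mul]
    congr 1
    rw [real_inner_comm, real_inner_comm (act Bᵀ ξ), inner_act_transpose, real_inner_comm]
  simp only [chirp, Submodule.coe_add, map_add, inner_add_left, inner_add_right,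
    real_inner_smul_right, ← ha]
  rw [h1, h2, h3, h4]
  ring

theorem exp_I_chirp_norm (t : ℝ) : ‖Complex.exp (Real.pi * Complex.I * t)‖ = 1 := by
  rw [show (Real.pi : ℂ) * Complex.I * t = ((Real.pi * t : ℝ) : ℂ) * Complex.I by push_cast; ring,
    Complex.norm_exp_ofReal_mul_I]

theorem conj_exp_I_chirp (t : ℝ) : starRingEnd ℂ (Complex.exp (Real.pi * Complex.I * t)) =
    Complex.exp (-(Real.pi * Complex.I * t)) := by
  rw [← Complex.exp_conj]; simp

/-- The Fourier transform of `|T f|²` in the coordinates `A k + B u` is the partial autocorrelation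
of the chirped `f` in the coordinates `Dᵀ A k + v`. -/
theorem IsMetaplectic.slice_identity {T : L2 d ≃ₗᵢ[ℂ] L2 d}
    (hT : IsMetaplectic (Matrix.fromBlocks A B C D) T) (f : L2 d)
    {e₁ e₂ : (kerM B × (kerM B)ᗮ) ≃L[ℝ] Rd d} (he₁ : ∀ p, e₁ p = act (Dᵀ * A) p.1 + p.2)
    (he₂ : ∀ p, e₂ p = act A p.1 + act B p.2) {c₁ c₂ : ℝ≥0∞}
    (h₁ : ((leb (kerM B)).prod (leb (kerM B)ᗮ)).map e₁ = c₁ • volume)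
    (h₂ : ((leb (kerM B)).prod (leb (kerM B)ᗮ)).map e₂ = c₂ • volume)
    (hc₂ : c₂ ≠ 0) (hc₂' : c₂ ≠ ∞) (b : kerM B) (a : (kerM B)ᗮ) :
    ((c₁.toReal / c₂.toReal : ℝ) : ℂ) *
      ∫ p, ((‖T f (e₂ p)‖ ^ 2 : ℝ) : ℂ) * Complex.exp (2 * Real.pi * Complex.I *
        ((inner ℝ b p.1 + inner ℝ a p.2 : ℝ) : ℂ)) ∂((leb (kerM B)).prod (leb (kerM B)ᗮ)) =
      ∫ p, (starRingEnd ℂ (f (e₁ p) * Complex.exp (Real.pi * Complex.I * chirp A B C p)) *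
        (f (e₁ (p.1, p.2 + a)) * Complex.exp (Real.pi * Complex.I * chirp A B C (p.1, p.2 + a)))) *
        Complex.exp (2 * Real.pi * Complex.I * (inner ℝ b p.1 : ℝ))
          ∂((leb (kerM B)).prod (leb (kerM B)ᗮ)) := by
  obtain ⟨ξ, hξ, ha⟩ := exists_dual_vector he₂ b a
  have hb : ∀ k : kerM B, inner ℝ b k = inner ℝ ξ (act A k) := fun k => by
    have := hξ (k, 0)
    rw [he₂] at this
    simpa using this.symm
  have hL := integral_comp_of_map_eq_smul e₂ h₂ (fun y => ((‖T f y‖ ^ 2 : ℝ) : ℂ) *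
    Complex.exp (2 * Real.pi * Complex.I * (inner ℝ ξ y : ℝ)))
  simp only [hξ] at hL
  have hR := integral_comp_of_map_eq_smul e₁ h₁ (fun y => starRingEnd ℂ (f y) *
    f (y + act Bᵀ ξ) * Complex.exp (2 * Real.pi * Complex.I *
      (inner ℝ (act Aᵀ ξ) (y + (2⁻¹ : ℝ) • act Bᵀ ξ) : ℝ)))
  rw [hL, hT.integral_normSq_mul_exp f ξ, ← mul_assoc, ← Complex.ofReal_mul,
    div_mul_cancel₀ _ (ENNReal.toReal_ne_zero.2 ⟨hc₂, hc₂'⟩), ← hR]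
  refine integral_congr_ae (Eventually.of_forall fun p => ?_)
  have hp : e₁ (p.1, p.2 + a) = e₁ p + act Bᵀ ξ := by
    rw [he₁, he₁, ha, Submodule.coe_add, add_assoc]
  have hch := chirp_add_sub hT.symplectic p.1 p.2 a ha
  simp only
  rw [hp, map_mul, conj_exp_I_chirp, hb, he₁ p]
  rw [show ∀ x y z w t : ℂ, (x * y) * (z * w) * t = x * z * (y * w * t) by intros; ring,
    ← Complex.exp_add, ← Complex.exp_add]
  congr 2
  have hch' : (chirp A B C (p.1, p.2 + a) : ℂ) - chirp A B C p +
      2 * ((inner ℝ ξ (act A p.1) : ℝ) : ℂ) = 2 * ((inner ℝ (act Aᵀ ξ)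
        (act (Dᵀ * A) p.1 + p.2 + (2⁻¹ : ℝ) • act Bᵀ ξ) : ℝ) : ℂ) := by
    exact_mod_cast hch
  linear_combination (-(Real.pi : ℂ) * Complex.I) * hch'

/-- A linear map injective on `W` identifies null sets of `W` and of its image. -/
theorem ae_submoduleMap (W : Submodule ℝ (Rd d)) (φ : Rd d →ₗ[ℝ] Rd d)
    (hφ : ∀ k ∈ W, φ k = 0 → k = 0) {p : W.map φ → Prop} (h : ∀ᵐ x ∂(leb (W.map φ)), p x) :
    ∀ᵐ k : W ∂(leb W), p ⟨φ k, Submodule.mem_map_of_mem k.2⟩ := by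
  have hinj : Function.Injective (φ.submoduleMap W) := by
    rw [← LinearMap.ker_eq_bot, LinearMap.ker_eq_bot']
    intro k hk
    exact Subtype.ext (hφ k k.2 (congrArg Subtype.val hk))
  set e := (LinearEquiv.ofBijective (φ.submoduleMap W)
    ⟨hinj, φ.submoduleMap_surjective W⟩).toContinuousLinearEquiv
  exact (quasiMeasurePreserving_linearEquiv e (leb W) (leb (W.map φ))).ae h

theorem ae_range (B : Matrix (Fin d) (Fin d) ℝ) {p : ranM B → Prop}
    (h : ∀ᵐ x ∂(leb (ranM B)), p x) :
    ∀ᵐ u : (kerM B)ᗮ ∂(leb (kerM B)ᗮ), p ⟨act B u, ⟨u, rfl⟩⟩ := by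
  set e := ((act B).kerComplementEquivRange
    (kerM B).isCompl_orthogonal.symm).toContinuousLinearEquiv
  exact (quasiMeasurePreserving_linearEquiv e (leb (kerM B)ᗮ) (leb (ranM B))).ae h

end Coordinates

/-! ### Assembly of the theorem. -/

section Main

open Filter Topology
open scoped FourierTransform

variable {d : ℕ} {A B C D : Matrix (Fin d) (Fin d) ℝ}

theorem norm_le_of_enorm_le {z : ℂ} {α : ℝ≥0∞} {t : ℝ} (hα : α < ∞)
    (h : ‖z‖ₑ ≤ α * ENNReal.ofReal (Real.exp t)) : ‖z‖ ≤ α.toReal * Real.exp t := by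
  have h1 := ENNReal.toReal_mono (ENNReal.mul_ne_top hα.ne ENNReal.ofReal_ne_top) h
  rwa [toReal_enorm, ENNReal.toReal_mul, ENNReal.toReal_ofReal (Real.exp_nonneg _)] at h1

/-- The square root of `M` on `(ker M)ᗮ`. -/
theorem exists_sqrt_equiv {R : Matrix (Fin d) (Fin d) ℝ} (hR : Rᵀ = R)
    (hK : kerM (R * R) = kerM B) :
    ∃ L : (kerM B)ᗮ ≃L[ℝ] (kerM B)ᗮ, (∀ v, (L v : Rd d) = act R v) ∧
      ∀ x y, inner ℝ (L x) y = inner ℝ x (L y) := by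
  have hsym : ∀ x y : Rd d, inner ℝ (act R x) y = inner ℝ x (act R y) := fun x y => by
    have := inner_act_transpose R x y
    rwa [hR] at this
  have hker : ∀ k ∈ kerM B, act R k = 0 := fun k hk => by
    rw [← hK, LinearMap.mem_ker, act_mul] at hk
    rw [← inner_self_eq_zero (𝕜 := ℝ), hsym, hk, inner_zero_right]
  have hmap : ∀ v ∈ (kerM B)ᗮ, act R v ∈ (kerM B)ᗮ := fun v hv => by
    rw [Submodule.mem_orthogonal]
    intro k hk
    rw [← hsym, hker k hk, inner_zero_left]
  have hinj : Function.Injective ((act R).restrict hmap) := by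
    rw [← LinearMap.ker_eq_bot, LinearMap.ker_eq_bot']
    intro v hv
    have h1 : act R v = 0 := congrArg Subtype.val hv
    have h2 : (v : Rd d) ∈ kerM (R * R) := by rw [LinearMap.mem_ker, act_mul, h1, map_zero]
    exact Subtype.ext (eq_zero_of_mem_kerM_of_mem_orthogonal (hK.le h2) v.2)
  exact ⟨(LinearEquiv.ofInjectiveEndo _ hinj).toContinuousLinearEquiv, fun v => rfl,
    fun x y => hsym x y⟩

theorem ae_eq_zero_of_comp {X Y : Type*} [NormedAddCommGroup X] [NormedSpace ℝ X]
    [FiniteDimensional ℝ X] [MeasurableSpace X] [BorelSpace X] [NormedAddCommGroup Y]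
    [NormedSpace ℝ Y] [MeasurableSpace Y] [BorelSpace Y] (e : X ≃L[ℝ] Y) {μ : Measure X}
    [μ.IsAddHaarMeasure] {ν : Measure Y} [ν.IsAddHaarMeasure] {f : Y → ℂ}
    (h : ∀ᵐ x ∂μ, f (e x) = 0) : f =ᵐ[ν] 0 := by
  filter_upwards [(quasiMeasurePreserving_linearEquiv e.symm ν μ).ae h] with y hy
  simpa using hy

end Main

end HardyMetaplectic

theorem theorem4p1 {d r : ℕ} (A B C D M N : Matrix (Fin d) (Fin d) ℝ)
    (T : L2 d ≃ₗᵢ[ℂ] L2 d)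
    (hT : IsMetaplectic (Matrix.fromBlocks A B C D) T)
    (hr : B.rank = r) (hr1 : 1 ≤ r)
    (hM : M.PosSemidef) (hN : N.PosSemidef)
    (hMB : kerM M = kerM B) (hNB : ranM N = ranM B)
    (f : L2 d) (hf : f ≠ 0)
    (α : ((kerM B).map (act (Dᵀ * A))) → ℝ≥0∞) (β : ((kerM B).map (act A)) → ℝ≥0∞)
    (hα : AEMeasurable α (leb _)) (hα_fin : ∀ᵐ x₂ ∂(leb _), α x₂ < ∞)
    (hβ : AEMeasurable β (leb _)) (hβ_fin : ∀ᵐ ξ₂ ∂(leb _), β ξ₂ < ∞)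
    (hf_decay : ∀ᵐ x₂ ∂(leb ((kerM B).map (act (Dᵀ * A)))), ∀ᵐ x₁ ∂(leb (kerM B)ᗮ),
      ‖f (x₁.1 + x₂.1)‖ₑ ≤
        α x₂ * ENNReal.ofReal (Real.exp (-Real.pi * inner ℝ (act M x₁.1) x₁.1)))
    (hTf_decay : ∀ᵐ ξ₂ ∂(leb ((kerM B).map (act A))), ∀ᵐ ξ₁ ∂(leb (ranM B)),
      ‖T f (ξ₁.1 + ξ₂.1)‖ₑ ≤
        β ξ₂ * ENNReal.ofReal (Real.exp (-Real.pi * inner ℝ (act N ξ₁.1) ξ₁.1))) :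
    (nonzeroEigenvalues (M * Bᵀ * N * B)).card = r ∧
    (∀ μ ∈ nonzeroEigenvalues (M * Bᵀ * N * B), μ ≤ 1) ∧
    ((∀ μ ∈ nonzeroEigenvalues (M * Bᵀ * N * B), μ = 1) →
      ∃ γ : kerM B → ℂ, MemLp γ 2 (leb (kerM B)) ∧
        ∀ᵐ x ∂(leb (kerM B)), ∀ᵐ x₁ ∂(leb (kerM B)ᗮ),
          f (x₁.1 + act (Dᵀ * A) x.1) =
            γ x *
              Complex.exp (-Real.pi *
                ((inner ℝ (act M x₁.1) x₁.1 : ℝ) +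
                  Complex.I * (inner ℝ (pinv B (act A x₁.1)) x₁.1 : ℝ))) *
              Complex.exp (-(2 * Real.pi * Complex.I *
                (inner ℝ (act (Cᵀ * A) x.1) x₁.1 : ℝ)))) := by
  have hS := hT.symplectic
  obtain ⟨R, hR, rfl⟩ := exists_symm_sqrt hM
  -- The Gaussian of N at B u is the Gaussian of P at u.
  set P : Matrix (Fin d) (Fin d) ℝ := Bᵀ * N * B with hPdef
  have hPker : kerM P = kerM B := kerM_congr_posSemidef hN hNB
  have hPpos : P.PosSemidef := by
    have := hN.conjTranspose_mul_mul_same B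
    rwa [Matrix.conjTranspose_eq_transpose_of_trivial] at this
  have hK : kerM (R * R) = kerM P := hMB.trans hPker.symm
  have hassoc : R * R * Bᵀ * N * B = R * R * P := by simp only [hPdef, Matrix.mul_assoc]
  rw [hassoc]
  refine ⟨by rw [card_nonzeroEigenvalues hR hPpos hK, rank_eq_of_kerM_eq hPker, hr], ?_⟩
  obtain ⟨L, hL, hLsym⟩ := exists_sqrt_equiv (B := B) hR hMB
  have hPmem : ∀ v ∈ (kerM B)ᗮ, act P v ∈ (kerM B)ᗮ := fun v _ => by
    rw [hPdef, act_mul, act_mul]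
    exact mem_orthogonal_kerM_act_transpose B _
  set Q : (kerM B)ᗮ →ₗ[ℝ] (kerM B)ᗮ := (act P).restrict hPmem
  have hQinner : ∀ u : (kerM B)ᗮ, inner ℝ (Q u) u = inner ℝ (act N (act B u)) (act B u) := by
    intro u
    rw [← inner_act_transpose, ← act_mul, ← act_mul]
    rfl
  have hQL : ∀ w : (kerM B)ᗮ, inner ℝ (Q (L w)) (L w) =
      inner ℝ (act P (act R w)) (act R (w : Rd d)) := by
    intro w
    rw [← hL]; rfl
  have hLnorm : ∀ v : (kerM B)ᗮ, ‖L v‖ ^ 2 = inner ℝ (act (R * R) v) (v : Rd d) := by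
    intro v
    have h1 := inner_act_transpose R (act R v) v
    rw [hR] at h1
    rw [act_mul, h1, ← hL, real_inner_self_eq_norm_sq]
    rfl
  obtain ⟨e₁, he₁⟩ := exists_decay_equiv hS
  obtain ⟨e₂, he₂⟩ := exists_range_equiv hS
  obtain ⟨c₁, hc₁, hc₁', h₁⟩ := exists_map_eq_smul_haar e₁
    ((leb (kerM B)).prod (leb (kerM B)ᗮ)) volume
  obtain ⟨c₂, hc₂, hc₂', h₂⟩ := exists_map_eq_smul_haar e₂
    ((leb (kerM B)).prod (leb (kerM B)ᗮ)) volume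
  set G : kerM B × (kerM B)ᗮ → ℂ :=
    fun p => f (e₁ p) * Complex.exp (Real.pi * Complex.I * chirp A B C p) with hGdef
  set H : kerM B × (kerM B)ᗮ → ℂ := fun p => T f (e₂ p) with hHdef
  have hnormG : ∀ p, ‖G p‖ = ‖f (e₁ p)‖ := fun p => by
    rw [hGdef]; simp only [norm_mul, exp_I_chirp_norm, mul_one]
  have hG2 : MemLp G 2 ((leb (kerM B)).prod (leb (kerM B)ᗮ)) := by
    have h := memLp_comp_of_map_eq_smul e₁ hc₁' h₁ (Lp.memLp f)
    have hcont : Continuous fun p : kerM B × (kerM B)ᗮ =>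
        Complex.exp (Real.pi * Complex.I * chirp A B C p) := by
      have := continuous_chirp (A := A) (B := B) (C := C)
      fun_prop
    exact h.of_le (h.1.mul hcont.aestronglyMeasurable) (Filter.Eventually.of_forall fun p =>
      (hnormG p).le)
  have hH2 : MemLp H 2 ((leb (kerM B)).prod (leb (kerM B)ᗮ)) :=
    memLp_comp_of_map_eq_smul e₂ hc₂' h₂ (Lp.memLp (T f))
  have hGdec : ∀ᵐ k : kerM B ∂(leb (kerM B)), ∃ a : ℝ, ∀ᵐ v : (kerM B)ᗮ ∂(leb (kerM B)ᗮ),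
      ‖G (k, v)‖ ≤ a * Real.exp (-Real.pi * ‖L v‖ ^ 2) := by
    have hinj : ∀ k ∈ kerM B, act (Dᵀ * A) k = 0 → k = 0 := fun k hk h =>
      eq_zero_of_act_mul_add_eq_zero hS hk (Submodule.zero_mem _) (by rw [h, add_zero])
    filter_upwards [ae_submoduleMap (kerM B) (act (Dᵀ * A)) hinj hα_fin,
      ae_submoduleMap (kerM B) (act (Dᵀ * A)) hinj hf_decay] with k h1 h2
    refine ⟨(α ⟨act (Dᵀ * A) k, Submodule.mem_map_of_mem k.2⟩).toReal, ?_⟩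
    filter_upwards [h2] with v h3
    rw [hnormG, he₁, hLnorm, add_comm]
    exact norm_le_of_enorm_le h1 h3
  have hHdec : ∀ᵐ k : kerM B ∂(leb (kerM B)), ∃ b : ℝ, ∀ᵐ u : (kerM B)ᗮ ∂(leb (kerM B)ᗮ),
      ‖H (k, u)‖ ≤ b * Real.exp (-Real.pi * inner ℝ (Q u) u) := by
    have hinj : ∀ k ∈ kerM B, act A k = 0 → k = 0 := fun k hk h =>
      eq_zero_of_act_add_act_eq_zero hS (y := 0) hk (by rw [h, map_zero, add_zero])
    filter_upwards [ae_submoduleMap (kerM B) (act A) hinj hβ_fin,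
      ae_submoduleMap (kerM B) (act A) hinj hTf_decay] with k h1 h2
    refine ⟨(β ⟨act A k, Submodule.mem_map_of_mem k.2⟩).toReal, ?_⟩
    filter_upwards [ae_range B h2] with u h3
    rw [hHdef, hQinner]
    simp only
    rw [he₂, add_comm]
    exact norm_le_of_enorm_le h1 h3
  have hGi : ∀ᵐ k : kerM B ∂(leb (kerM B)), Integrable (fun v => G (k, v)) (leb (kerM B)ᗮ) ∧
      MemLp (fun v => G (k, v)) 2 (leb (kerM B)ᗮ) := by
    filter_upwards [hG2.1.prodMk_left, hGdec] with k hk ⟨a, ha⟩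
    exact integrable_of_gaussian_bound_comp L hk ha
  -- The constant is the ratio of the Jacobians of the two coordinate systems.
  have hHG := ae_normSq_eq_partial_fourier hG2 hH2 hGi
    (c := c₁.toReal / c₂.toReal) (by positivity)
    (fun b a => hT.slice_identity f he₁ he₂ h₁ h₂ hc₂ hc₂' b a)
  have hdec := ae_forall_fourier_bound L hG2 hGdec Q hHdec (by positivity) hHG
  constructor
  · intro μ hμ
    by_contra hlt
    push Not at hlt
    obtain ⟨w, hw, hw0, hwμ⟩ := exists_of_mem_nonzeroEigenvalues hR hPpos hK hμ
    rw [hPker] at hw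
    -- An eigenvector for μ > 1 violates Hardy's condition, so almost every slice vanishes and f =
    -- 0.
    have hzero := slices_eq_zero L hLsym Q hG2.1 hdec (w := ⟨w, hw⟩) (by
      rw [hQL]
      refine lt_of_lt_of_eq ?_ hwμ.symm
      have : 0 < ‖w‖ ^ 2 := by positivity
      change ‖w‖ ^ 2 < μ * ‖w‖ ^ 2
      nlinarith)
    refine hf ((Lp.eq_zero_iff_ae_eq_zero).2 (ae_eq_zero_of_comp e₁
      (μ := (leb (kerM B)).prod (leb (kerM B)ᗮ)) ?_))
    filter_upwards [hzero] with p hp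
    have := hnormG p
    rw [hp] at this
    simpa using this.symm
  · intro hone
    obtain ⟨γ, hγ, hγeq⟩ := slices_eq_gaussian L hLsym Q hG2 hdec fun w => by
      rw [hQL]
      exact inner_eq_of_nonzeroEigenvalues_eq_one hR hPpos hK hone
        (Submodule.orthogonal_le hPker.le w.2)
    refine ⟨γ, hγ, ?_⟩
    filter_upwards [hγeq] with k hk
    filter_upwards [hk] with v hv
    -- Undoing the chirp produces the phase B⁺A in the Gaussian and the modulation by CᵀA k.
    have h1 : f (e₁ (k, v)) = G (k, v) *
        Complex.exp (-(Real.pi * Complex.I * chirp A B C (k, v))) := by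
      rw [hGdef]
      simp only
      rw [mul_assoc, ← Complex.exp_add, add_neg_cancel, Complex.exp_zero, mul_one]
    rw [add_comm, ← he₁ (k, v), h1, hv, mul_assoc (γ k), mul_assoc (γ k),
      ← Complex.exp_add, ← Complex.exp_add]
    congr 2
    have h2 : ((‖L v‖ : ℂ)) ^ 2 = ((inner ℝ (act (R * R) v) (v : Rd d) : ℝ) : ℂ) := by
      exact_mod_cast congrArg Complex.ofReal (hLnorm v)
    rw [h2, chirp]
    push_cast
    ring
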